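/- Let $k$ be a field, $n\ge 0$, and $R=k[x_1,\dots,x_n]$ with the standard grading; all modules are finitely generated and $\mathbb Z$-graded, and a Cohen–Macaulay module is in particular nonzero. The Betti diagram of $M$ is $\beta(M)=(\beta_{i,j}(M))$, where $\bigoplus_j R(-j)^{\beta_{i,j}(M)}$ is the $i$-th term of a minimal graded free resolution of $M$; the codimension of $M$ is $\dim R-\dim M$; the normalized Betti diagram is $\beta(M)/\beta_0$, where $\beta_0=\sum_j\beta_{0,j}(M)$. For strictly increasing integer sequences $\underline d=(\underline d_0,\dots,\underline d_p)$ and $\overline d=(\overline d_0,\dots,\overline d_p)$ let $V_{\underline d,\overline d}$ be the $\mathbb Q$-vector space of matrices $(\beta_{i,j})$ with $\beta_{i,j}=0$ unless $0\le i\le p$ and $\underline d_i\le j\le\overline d_i$, and with $\sum_{i,j}(-1)^i j^s\beta_{i,j}=0$ for $s=0,\dots,p-1$. Let $\overline B_{\underline d,\overline d}$ be the set of normalized Betti diagrams of Cohen–Macaulay $R$-modules that lie in $V_{\underline d,\overline d}$. For a strictly increasing integer sequence $d=(d_0,\dots,d_p)$ the pure diagram $\pi(d)$ (of codimension $p$)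 is given by $\pi(d)_{0,d_0}=1$, $$\pi(d)_{i,d_i}=(-1)^{i+1}\prod_{k\ne 0,i}\frac{d_k-d_0}{d_k-d_i}\qquad(1\le i\le p),$$ and all other entries $0$; pure diagrams are ordered by $\pi(d)\le\pi(d')$ iff $d_i\le d'_i$ for all $i$. Let $\Pi_{\underline d,\overline d}$ be the poset of pure diagrams $\pi(d)$ with $\underline d\le d\le\overline d$. The geometric order complex $\Delta(\Pi_{\underline d,\overline d})$ is the union of the convex hulls (over $\mathbb Q$) of the chains of $\Pi_{\underline d,\overline d}$. Corollary 2.12 (strictly quasipure resolutions). 1. Let $M$ be a Cohen–Macaulay $R$-module of codimension $p$ with strictly quasipure resolution, that is, $\max\{j:\beta_{i-1,j}(M)\ne0\}<\min\{j:\beta_{i,j}(M)\ne0\}$ for $1\le i\le p$. Then $\beta(M)$ is a non-negative rational linear combination of pure diagrams of codimension $p$. 2. Let $\underline d$, $\overline d$ be strictly increasing integer sequences of length $p+1$ with $\overline d_{i-1}<\underline d_i$ for $1\le i\le p$. Then $\overline B_{\underline d,\overline d}\subseteq\Delta(\Pi_{\underline d,\overline d})$, and $\Delta(\Pi_{\underline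 d,\overline d})$ equals the convex hull (over $\mathbb Q$) of $\Pi_{\underline d,\overline d}$. -/

import Mathlib

universe u v

noncomputable section

/-! ### Diagrams, pure diagrams and the order complex -/

/-- A diagram: a matrix of rational numbers `D i j`, with homological index `i` and degree `j`. -/
abbrev Diagram : Type := ℕ → ℤ → ℚ

/-- The rational vector space of the matrices `D` whose entries vanish outside the window
`dl i ≤ j ≤ du i`, `0 ≤ i ≤ p`, and which satisfy the linear equations
`∑ (-1)^i j^s D i j = 0` for `s = 0, …, p - 1`. -/
def diagramSpace {p : ℕ} (dl du : Fin (p + 1) → ℤ) : Submodule ℚ Diagram where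
  carrier := {D |
    (∀ s < p, ∑ i : Fin (p + 1), ∑ j ∈ Finset.Icc (dl i) (du i),
      (-1 : ℚ) ^ (i : ℕ) * (j : ℚ) ^ s * D i j = 0) ∧
    (∀ (i : Fin (p + 1)) (j : ℤ), j < dl i ∨ du i < j → D i j = 0) ∧
    (∀ (i : ℕ) (j : ℤ), p < i → D i j = 0)}
  zero_mem' := by simp
  add_mem' := by
    rintro D E ⟨h1, h2, h3⟩ ⟨g1, g2, g3⟩
    refine ⟨fun s hs => ?_, fun i j h => ?_, fun i j h => ?_⟩
    · simp only [Pi.add_apply, mul_add, Finset.sum_add_distrib, h1 s hs, g1 s hs, add_zero]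
    · simp [h2 i j h, g2 i j h]
    · simp [h3 i j h, g3 i j h]
  smul_mem' := by
    rintro c D ⟨h1, h2, h3⟩
    refine ⟨fun s hs => ?_, fun i j h => ?_, fun i j h => ?_⟩
    · simp only [Pi.smul_apply, smul_eq_mul, mul_left_comm _ c, ← Finset.mul_sum, h1 s hs,
        mul_zero]
    · simp [h2 i j h]
    · simp [h3 i j h]

/-- The pure diagram `π(d)` of a sequence `d = (d₀, …, d_p)`. Its entry in position `(i, d i)` is
`1` for `i = 0` and `(-1)^(i+1) ∏_{k ≠ 0, i} (d k - d 0) / (d k - d i)` for `1 ≤ i ≤ p`; all other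
entries vanish. -/
def pureDiagram {p : ℕ} (d : Fin (p + 1) → ℤ) : Diagram := fun i j =>
  if h : i < p + 1 then
    if j = d ⟨i, h⟩ then
      if i = 0 then 1
      else (-1) ^ (i + 1) * ∏ k ∈ Finset.univ.filter (fun k : Fin (p + 1) => k ≠ ⟨i, h⟩ ∧ k ≠ 0),
        ((d k - d 0 : ℤ) : ℚ) / ((d k - d ⟨i, h⟩ : ℤ) : ℚ)
    else 0
  else 0

/-- The types of the pure diagrams in the interval: the strictly increasing integer sequences `d`
with `dl ≤ d ≤ du`. The order is the componentwise one. -/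
def pureTypes {p : ℕ} (dl du : Fin (p + 1) → ℤ) : Set (Fin (p + 1) → ℤ) :=
  {d | StrictMono d ∧ dl ≤ d ∧ d ≤ du}

/-- The set of all pure diagrams between `π(dl)` and `π(du)`. -/
def pureDiagrams {p : ℕ} (dl du : Fin (p + 1) → ℤ) : Set Diagram :=
  pureDiagram '' pureTypes dl du

/-- The geometric order complex: the union, over all chains of pure diagrams, of the simplices
(rational convex hulls) spanned by the chains. The order on pure diagrams is that of their
types. -/
def orderComplex {p : ℕ} (dl du : Fin (p + 1) → ℤ) : Set Diagram :=
  ⋃ C ∈ {C : Set (Fin (p + 1) → ℤ) | C ⊆ pureTypes dl du ∧ IsChain (· ≤ ·) C},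
    convexHull ℚ (pureDiagram '' C)

/-- A diagram is strictly quasipure if every degree occurring in column `i` is smaller than every
degree occurring in column `i + 1`, that is, the maximal shift in homological degree `i` is smaller
than the minimal shift in homological degree `i + 1`. -/
def StrictlyQuasipure (D : Diagram) : Prop :=
  ∀ (i : ℕ) (j j' : ℤ), D i j ≠ 0 → D (i + 1) j' ≠ 0 → j < j'

/-- Division of a diagram by `β₀ = ∑ j, D 0 j`. -/
def Diagram.normalize (D : Diagram) : Diagram := fun i j => D i j / ∑ᶠ l : ℤ, D 0 l

/-! ### Graded modules over the polynomial ring and their Betti diagrams -/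

section Modules

variable {k : Type u} [Field k] {n : ℕ} {M : Type v} [AddCommGroup M]
  [Module (MvPolynomial (Fin n) k) M]

/-- `ℳ` makes `M` a `ℤ`-graded module over the standard graded polynomial ring. -/
structure IsModuleGrading (ℳ : ℤ → AddSubgroup M) : Prop where
  isInternal : DirectSum.IsInternal ℳ
  smul_mem : ∀ (e : ℕ) (j : ℤ) (f : MvPolynomial (Fin n) k) (m : M),
    f.IsHomogeneous e → m ∈ ℳ j → f • m ∈ ℳ (e + j)

/-- A finite minimal graded free resolution of `M`. The `i`-th module is
`⨁ s, R(-shift i s)`, with the standard basis vector `Pi.single s 1` in degree `shift i s`; the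
maps preserve degrees, and the matrix entries of the differentials have no constant term. -/
structure MinimalFreeResolution (ℳ : ℤ → AddSubgroup M) where
  /-- the rank of the `i`-th free module -/
  rank : ℕ → ℕ
  /-- the degrees of the basis elements of the `i`-th free module -/
  shift : (i : ℕ) → Fin (rank i) → ℤ
  /-- the augmentation -/
  aug : (Fin (rank 0) → MvPolynomial (Fin n) k) →ₗ[MvPolynomial (Fin n) k] M
  /-- the differentials -/
  diff : (i : ℕ) → (Fin (rank (i + 1)) → MvPolynomial (Fin n) k) →ₗ[MvPolynomial (Fin n) k]
    (Fin (rank i) → MvPolynomial (Fin n) k)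
  finite_length : ∃ N : ℕ, ∀ i, N < i → rank i = 0
  aug_mem : ∀ s, aug (Pi.single s 1) ∈ ℳ (shift 0 s)
  diff_homogeneous : ∀ i s t, diff i (Pi.single s 1) t = 0 ∨
    ∃ e : ℕ, (e : ℤ) = shift (i + 1) s - shift i t ∧ (diff i (Pi.single s 1) t).IsHomogeneous e
  minimal : ∀ i s t, MvPolynomial.constantCoeff (diff i (Pi.single s 1) t) = 0
  aug_surjective : Function.Surjective aug
  exact_zero : Function.Exact (diff 0) aug
  exact_succ : ∀ i, Function.Exact (diff (i + 1)) (diff i)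

/-- The Betti diagram: `β i j` is the number of summands `R(-j)` in the `i`-th free module. -/
def MinimalFreeResolution.bettiDiagram {ℳ : ℤ → AddSubgroup M}
    (F : MinimalFreeResolution (k := k) (n := n) ℳ) : Diagram :=
  fun i j => ((Finset.univ.filter (fun s => F.shift i s = j)).card : ℚ)

variable (k n M)

/-- The depth of `M` with respect to the irrelevant maximal ideal `(x₁, …, x_n)`: the supremum of
the lengths of the `M`-regular sequences of polynomials without constant term. -/
def irrelevantDepth : ℕ∞ :=
  ⨆ (rs : List (MvPolynomial (Fin n) k))
    (_ : (∀ f ∈ rs, MvPolynomial.constantCoeff f = 0) ∧ RingTheory.Sequence.IsRegular M rs),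
    (rs.length : ℕ∞)

/-- A (finitely generated graded) module is Cohen-Macaulay if it is nonzero and its depth equals
its Krull dimension. -/
def IsCohenMacaulay : Prop :=
  Nontrivial M ∧
    (irrelevantDepth k n M : WithBot ℕ∞) = Module.supportDim (MvPolynomial (Fin n) k) M

end Modules

/-- The set of all normalized Betti diagrams in `diagramSpace dl du`: the normalizations of the
Betti diagrams, lying in that space, of the Cohen-Macaulay finitely generated graded modules over
the polynomial ring in `n` variables over `k`. -/
def normalizedBettiDiagrams (k : Type u) [Field k] (n : ℕ) {p : ℕ} (dl du : Fin (p + 1) → ℤ) :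
    Set Diagram :=
  {D | ∃ (M : Type v) (_ : AddCommGroup M) (_ : Module (MvPolynomial (Fin n) k) M)
    (ℳ : ℤ → AddSubgroup M) (F : MinimalFreeResolution (k := k) (n := n) ℳ),
    Module.Finite (MvPolynomial (Fin n) k) M ∧ IsModuleGrading (k := k) (n := n) ℳ ∧
    IsCohenMacaulay k n M ∧ F.bettiDiagram ∈ diagramSpace dl du ∧ D = F.bettiDiagram.normalize}

end

/-!
The statement has a combinatorial part about diagrams and an algebraic part that places the Betti
diagram of a Cohen–Macaulay module in the setting of the first.

Combinatorics. Let `D` be a nonzero non-negative diagram in `diagramSpace dl du`, where the windows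
of consecutive columns are disjoint. Testing the `p` equations against a polynomial of degree `< p`
with prescribed signs on the windows shows that `D` has no zero column
(`exists_entry_ne_zero`). So the least degrees of the columns are the type of a pure diagram
`π(d)`, which satisfies the same equations by Lagrange interpolation
(`pureDiagram_mem_diagramSpace`). The largest multiple of `π(d)` that keeps the difference
non-negative is subtracted, one entry disappears, and the next type is larger: this gives a
non-negative combination of the pure diagrams of a chain (`exists_chain_decomposition`). The second
half of the theorem follows by comparing the sums of column `0`, without any property of modules
beyond `M ≠ 0`.

Algebra. For the first half, the Betti diagram of a Cohen–Macaulay module `M` of codimension `p`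
has to be placed in `diagramSpace dl du` with disjoint windows. Two facts are needed.

* The minimal resolution has length at most `p` (`MinimalFreeResolution.rank_eq_zero`). This is the
  inequality `pd M ≤ n - depth M` of Auslander and Buchsbaum, proved with the modules `Ext(K, _)`,
  where `K` is the residue field at the origin. They vanish below `depth M` on `M`
  and below `n` on free modules, and this range grows by one with each syzygy. If the resolution
  were longer, the last differential would be injective on `Ext^n(K, _)`; it is also zero there by
  minimality, but `Ext^n(K, _)` does not vanish on nonzero free modules.
* The equations hold (`MinimalFreeResolution.alternating_sum_shift_pow_eq_zero`). The dimension of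
  the part of `M` in degrees `≤ m` is an alternating sum of translates of `(m + n).choose n`, a
  polynomial in `m` for large `m`. Noether normalization bounds its degree by `dim M = n - p`
  (`exists_finrank_map_pi_restrictTotalDegree_le`), and then the power sums of the translations of
  order `< p` vanish (`sum_mul_pow_eq_zero_of_natDegree_le`).
-/

/-! ### Pure diagrams -/

section PureDiagrams

variable {p : ℕ} {d dl du : Fin (p + 1) → ℤ}

theorem pureDiagram_eq_zero_of_ne {i : Fin (p + 1)} {j : ℤ} (h : j ≠ d i) :
    pureDiagram d i j = 0 := by
  simp [pureDiagram, h]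

theorem pureDiagram_eq_zero_of_lt {i : ℕ} (j : ℤ) (h : p < i) : pureDiagram d i j = 0 := by
  simp [pureDiagram, show ¬ i < p + 1 by omega]

theorem pureDiagram_zero_self : pureDiagram d 0 (d 0) = 1 := by
  simp [pureDiagram]

theorem pureDiagram_self {i : Fin (p + 1)} (hi : i ≠ 0) :
    pureDiagram d i (d i) = (-1) ^ ((i : ℕ) + 1) * ∏ k ∈ (Finset.univ.erase i).erase 0,
      ((d k - d 0 : ℤ) : ℚ) / ((d k - d i : ℤ) : ℚ) := by
  have h : (Finset.univ.erase i).erase 0 =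
      Finset.univ.filter (fun k : Fin (p + 1) => k ≠ i ∧ k ≠ 0) := by
    ext k; simp [and_comm]
  rw [h]
  simp only [pureDiagram, i.2, dif_pos, Fin.eta, if_true]
  rw [if_neg (fun h0 : (i : ℕ) = 0 => hi (Fin.ext h0))]

theorem prod_ite_lt_eq_neg_one_pow (m i : ℕ) (hi : i ≤ m) :
    ∏ l : Fin m, (if (l : ℕ) < i then (-1 : ℚ) else 1) = (-1) ^ i := by
  rw [Fin.prod_univ_eq_prod_range (fun l => if l < i then (-1 : ℚ) else 1) m, Finset.prod_ite,
    Finset.prod_const_one, mul_one, Finset.prod_const]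
  congr 1
  have : (Finset.range m).filter (· < i) = Finset.range i := by
    ext l; simp only [Finset.mem_filter, Finset.mem_range]; omega
  rw [this, Finset.card_range]

theorem pureDiagram_self_pos (hd : StrictMono d) (i : Fin (p + 1)) :
    0 < pureDiagram d i (d i) := by
  rcases eq_or_ne i 0 with rfl | hi
  · simp [pureDiagram_zero_self]
  -- The sign `(-1)^(i+1)` cancels the signs of the factors with `0 < k < i`.
  have hs : (-1 : ℚ) ^ ((i : ℕ) + 1) =
      ∏ k ∈ (Finset.univ.erase i).erase 0, (if k < i then (-1 : ℚ) else 1) := by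
    have h := prod_ite_lt_eq_neg_one_pow (p + 1) i i.2.le
    rw [← Finset.mul_prod_erase _ _ (Finset.mem_univ i),
      ← Finset.mul_prod_erase _ _ (Finset.mem_erase.2 ⟨hi.symm, Finset.mem_univ (0 : Fin (p + 1))⟩)]
      at h
    have h0 : (0 : Fin (p + 1)) < i := Fin.pos_iff_ne_zero.2 hi
    simp only [lt_irrefl, if_false, one_mul, ← Fin.lt_def, h0, if_true] at h
    rw [pow_succ, ← h]; ring
  rw [pureDiagram_self hi, hs, ← Finset.prod_mul_distrib]
  refine Finset.prod_pos fun k hk => ?_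
  simp only [Finset.mem_erase, Finset.mem_univ, and_true] at hk
  have h0 : (0 : ℚ) < ((d k - d 0 : ℤ) : ℚ) := by
    exact_mod_cast sub_pos.2 (hd (Fin.pos_iff_ne_zero.2 hk.1))
  split_ifs with h
  · have : ((d k - d i : ℤ) : ℚ) < 0 := by exact_mod_cast sub_neg.2 (hd h)
    rw [neg_one_mul, neg_pos]
    exact div_neg_of_pos_of_neg h0 this
  · have : (0 : ℚ) < ((d k - d i : ℤ) : ℚ) := by
      exact_mod_cast sub_pos.2 (hd (lt_of_le_of_ne (not_lt.1 h) (Ne.symm hk.2)))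
    rw [one_mul]
    exact div_pos h0 this

theorem pureDiagram_nonneg (hd : StrictMono d) (i : ℕ) (j : ℤ) : 0 ≤ pureDiagram d i j := by
  by_cases hi : i < p + 1
  · by_cases hj : j = d ⟨i, hi⟩
    · rw [hj]; exact (pureDiagram_self_pos hd ⟨i, hi⟩).le
    · exact (pureDiagram_eq_zero_of_ne (i := ⟨i, hi⟩) hj).ge
  · exact (pureDiagram_eq_zero_of_lt j (by omega)).ge

/-- The linear equations hold for a pure diagram: this is Lagrange interpolation of `x ^ s` at the
nodes `d 1, …, d p`, evaluated at `d 0`. -/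
theorem pureDiagram_alternating_sum (hd : StrictMono d) {s : ℕ} (hs : s < p) :
    ∑ i : Fin (p + 1), (-1 : ℚ) ^ (i : ℕ) * (d i : ℚ) ^ s * pureDiagram d i (d i) = 0 := by
  classical
  set S : Finset (Fin (p + 1)) := Finset.univ.erase 0
  have hinj : Set.InjOn (fun i => (d i : ℚ)) S :=
    fun a _ b _ h => hd.injective (Int.cast_injective h)
  have hdeg : (Polynomial.X ^ s : Polynomial ℚ).degree < S.card := by
    rw [Polynomial.degree_X_pow]
    simpa [S] using hs
  have h := congrArg (Polynomial.eval (d 0 : ℚ)) (Lagrange.eq_interpolate hinj hdeg)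
  simp only [Polynomial.eval_pow, Polynomial.eval_X, Lagrange.interpolate_apply,
    Polynomial.eval_finsetSum, Polynomial.eval_mul, Polynomial.eval_C] at h
  rw [← Finset.add_sum_erase _ _ (Finset.mem_univ (0 : Fin (p + 1))), Fin.val_zero, pow_zero,
    pureDiagram_zero_self, one_mul, mul_one, h, ← Finset.sum_add_distrib]
  refine Finset.sum_eq_zero fun i hi => ?_
  have hi0 : i ≠ 0 := (Finset.mem_erase.1 hi).1
  rw [pureDiagram_self hi0, Lagrange.basis, Polynomial.eval_prod]
  have hset : (Finset.univ.erase i).erase (0 : Fin (p + 1)) = S.erase i :=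
    Finset.erase_right_comm
  have hprod : ∏ k ∈ S.erase i, Polynomial.eval (d 0 : ℚ)
      (Lagrange.basisDivisor (d i : ℚ) (d k : ℚ)) =
      ∏ k ∈ S.erase i, ((d k - d 0 : ℤ) : ℚ) / ((d k - d i : ℤ) : ℚ) := by
    refine Finset.prod_congr rfl fun k hk => ?_
    have hki : (d k : ℚ) - d i ≠ 0 := by
      rw [sub_ne_zero]
      exact fun h => (Finset.mem_erase.1 hk).1 (hd.injective (by exact_mod_cast h))
    have hik : (d i : ℚ) - d k ≠ 0 := by rw [← neg_sub]; exact neg_ne_zero.2 hki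
    simp only [Lagrange.basisDivisor, Polynomial.eval_mul, Polynomial.eval_C, Polynomial.eval_sub,
      Polynomial.eval_X, Int.cast_sub]
    field_simp
    ring
  rw [hset, hprod]
  have : (-1 : ℚ) ^ (i : ℕ) * (-1) ^ ((i : ℕ) + 1) = -1 := by
    rw [← pow_add, ← add_assoc, ← two_mul]
    exact Odd.neg_one_pow ⟨i, rfl⟩
  linear_combination (d i : ℚ) ^ s *
    (∏ k ∈ S.erase i, ((d k - d 0 : ℤ) : ℚ) / ((d k - d i : ℤ) : ℚ)) * this

theorem pureDiagram_mem_diagramSpace (hd : d ∈ pureTypes dl du) :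
    pureDiagram d ∈ diagramSpace dl du := by
  obtain ⟨hmono, hl, hu⟩ := hd
  refine ⟨fun s hs => ?_, fun i j h => pureDiagram_eq_zero_of_ne ?_,
    fun i j h => pureDiagram_eq_zero_of_lt j h⟩
  · rw [← pureDiagram_alternating_sum hmono hs]
    refine Finset.sum_congr rfl fun i _ => Finset.sum_eq_single (d i) (fun j _ hj => ?_) ?_
    · rw [pureDiagram_eq_zero_of_ne hj, mul_zero]
    · exact fun h => absurd (Finset.mem_Icc.2 ⟨hl i, hu i⟩) h
  · rintro rfl
    rcases h with h | h
    · exact absurd (hl i) (not_le.2 h)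
    · exact absurd (hu i) (not_le.2 h)

end PureDiagrams

/-! ### Greedy decomposition in disjoint windows -/

section Decomposition

variable {p : ℕ} {dl du : Fin (p + 1) → ℤ} {D : Diagram}

theorem mem_window_of_ne_zero (hD : D ∈ diagramSpace dl du) {i : Fin (p + 1)} {j : ℤ}
    (h : D i j ≠ 0) : dl i ≤ j ∧ j ≤ du i := by
  by_contra hc
  exact h (hD.2.1 i j (by rw [not_and_or, not_le, not_le] at hc; exact hc))

/-- The equations defining `diagramSpace`, for an arbitrary test polynomial of degree `< p`. -/
theorem sum_eval_eq_zero (hD : D ∈ diagramSpace dl du) {q : Polynomial ℚ} (hq : q.natDegree < p) :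
    ∑ i : Fin (p + 1), ∑ j ∈ Finset.Icc (dl i) (du i),
      (-1 : ℚ) ^ (i : ℕ) * q.eval (j : ℚ) * D i j = 0 := by
  have h : ∀ i : Fin (p + 1), ∑ j ∈ Finset.Icc (dl i) (du i),
      (-1 : ℚ) ^ (i : ℕ) * q.eval (j : ℚ) * D i j = ∑ s ∈ Finset.range p, q.coeff s *
        ∑ j ∈ Finset.Icc (dl i) (du i), (-1 : ℚ) ^ (i : ℕ) * (j : ℚ) ^ s * D i j := by
    intro i
    simp_rw [Finset.mul_sum]
    rw [Finset.sum_comm]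
    refine Finset.sum_congr rfl fun j _ => ?_
    rw [Polynomial.eval_eq_sum_range' hq, Finset.mul_sum, Finset.sum_mul]
    exact Finset.sum_congr rfl fun s _ => by ring
  simp_rw [h]
  rw [Finset.sum_comm]
  refine Finset.sum_eq_zero fun s hs => ?_
  rw [← Finset.mul_sum, hD.1 s (Finset.mem_range.1 hs), mul_zero]

/-- A nonzero non-negative diagram in `diagramSpace dl du` with disjoint windows has no zero
column. If column `i₀` were zero, then a polynomial of degree `< p` could be chosen with sign
`(-1)^i` on the window of each column `i ≠ i₀`, because the separator between two neighbouring
windows is not needed next to `i₀`. Testing the equations against it gives a sum of non-negative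
terms, not all zero. -/
theorem exists_entry_ne_zero (hl : StrictMono dl) (hu : StrictMono du)
    (hlu : ∀ i : Fin p, du i.castSucc < dl i.succ) (hD : D ∈ diagramSpace dl du)
    (hpos : ∀ i j, 0 ≤ D i j) (hne : D ≠ 0) (i₀ : Fin (p + 1)) : ∃ j, D i₀ j ≠ 0 := by
  classical
  by_contra! hzero
  -- `e l` separates the windows of the columns `≤ l` from those of the columns `> l`.
  set e : Fin p → ℚ := fun l => (du l.castSucc : ℚ) + 1 / 2 with he
  have heneg : ∀ (l : Fin p) (i : Fin (p + 1)) (j : ℤ), (l : ℕ) < i → dl i ≤ j → e l - j < 0 := by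
    intro l i j hli hj
    have h1 : du l.castSucc + 1 ≤ j :=
      (Int.add_one_le_of_lt (hlu l)).trans ((hl.monotone (Fin.le_def.2 (Nat.succ_le_of_lt hli))).trans hj)
    have h2 : (du l.castSucc : ℚ) + 1 ≤ j := by exact_mod_cast h1
    simp only [he]; linarith
  have hepos : ∀ (l : Fin p) (i : Fin (p + 1)) (j : ℤ), (i : ℕ) ≤ l → j ≤ du i → 0 < e l - j := by
    intro l i j hli hj
    have h1 : j ≤ du l.castSucc := hj.trans (hu.monotone (Fin.le_def.2 hli))
    have h2 : (j : ℚ) ≤ du l.castSucc := by exact_mod_cast h1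
    simp only [he]; linarith
  have hfull : ∀ (i : Fin (p + 1)) (j : ℤ), dl i ≤ j → j ≤ du i →
      0 < (-1 : ℚ) ^ (i : ℕ) * ∏ l, (e l - j) := by
    intro i j h1 h2
    rw [← prod_ite_lt_eq_neg_one_pow p i (Nat.lt_succ_iff.1 i.2), ← Finset.prod_mul_distrib]
    refine Finset.prod_pos fun l _ => ?_
    split_ifs with h
    · linarith [heneg l i j h h1]
    · linarith [hepos l i j (not_lt.1 h) h2]
  obtain ⟨a, b, hab⟩ : ∃ a b, D a b ≠ 0 := by
    by_contra! h
    exact hne (funext fun a => funext fun b => h a b)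
  have ha : a < p + 1 := by
    by_contra h
    exact hab (hD.2.2 a b (by omega))
  have hai : (⟨a, ha⟩ : Fin (p + 1)) ≠ i₀ := by
    rintro rfl
    exact hab (hzero b)
  -- The separators next to the column `i₀` contribute a constant sign.
  obtain ⟨T, ε, hT, hε⟩ : ∃ (T : Finset (Fin p)) (ε : ℚ), T.Nonempty ∧
      ∀ (i : Fin (p + 1)) (j : ℤ), i ≠ i₀ → dl i ≤ j → j ≤ du i →
        0 < ε * ∏ l ∈ T, (e l - j) := by
    have hp : 0 < p := by
      rcases Nat.eq_zero_or_pos p with rfl | h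
      · exact absurd (Fin.ext (by omega)) hai
      · exact h
    rcases Nat.eq_zero_or_pos (i₀ : ℕ) with h0 | h0
    · refine ⟨{⟨0, hp⟩}, -1, Finset.singleton_nonempty _, fun i j hi h1 h2 => ?_⟩
      have hi0 : 0 < (i : ℕ) := by
        have := Fin.val_ne_of_ne hi
        omega
      rw [Finset.prod_singleton]
      linarith [heneg ⟨0, hp⟩ i j hi0 h1]
    · by_cases hlast : (i₀ : ℕ) = p
      · refine ⟨{⟨p - 1, by omega⟩}, 1, Finset.singleton_nonempty _, fun i j hi h1 h2 => ?_⟩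
        have hi0 : (i : ℕ) ≤ p - 1 := by
          have := Fin.val_ne_of_ne hi
          omega
        rw [Finset.prod_singleton]
        linarith [hepos ⟨p - 1, by omega⟩ i j hi0 h2]
      · have hlt : (i₀ : ℕ) < p := by omega
        refine ⟨{⟨i₀ - 1, by omega⟩, ⟨i₀, hlt⟩}, 1, ⟨_, Finset.mem_insert_self _ _⟩,
          fun i j hi h1 h2 => ?_⟩
        have hne' : (⟨i₀ - 1, by omega⟩ : Fin p) ≠ ⟨i₀, hlt⟩ := by
          rw [Ne, Fin.mk.injEq]; omega
        rw [Finset.prod_pair hne', one_mul]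
        rcases lt_or_gt_of_ne (Fin.val_ne_of_ne hi) with h | h
        · exact mul_pos (hepos _ i j (show (i : ℕ) ≤ i₀ - 1 by omega) h2)
            (hepos _ i j (show (i : ℕ) ≤ i₀ by omega) h2)
        · exact mul_pos_of_neg_of_neg (heneg _ i j (show (i₀ : ℕ) - 1 < i by omega) h1)
            (heneg _ i j h h1)
  set q : Polynomial ℚ := Polynomial.C ε * ∏ l ∈ Tᶜ, (Polynomial.C (e l) - Polynomial.X) with hq
  have hqdeg : q.natDegree < p := by
    have h1 : (∏ l ∈ Tᶜ, (Polynomial.C (e l) - Polynomial.X)).natDegree ≤ ∑ l ∈ Tᶜ, 1 :=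
      (Polynomial.natDegree_prod_le _ _).trans (Finset.sum_le_sum fun l _ =>
        (Polynomial.natDegree_sub_le _ _).trans (by simp))
    have h2 := (Polynomial.natDegree_C_mul_le ε _).trans h1
    have h3 : Tᶜ.card < p := by
      have := T.card_compl_lt_iff_nonempty.2 hT
      simpa using this
    rw [Finset.sum_const, smul_eq_mul, mul_one] at h2
    exact lt_of_le_of_lt h2 h3
  have hqpos : ∀ (i : Fin (p + 1)) (j : ℤ), i ≠ i₀ → dl i ≤ j → j ≤ du i →
      0 < (-1 : ℚ) ^ (i : ℕ) * q.eval (j : ℚ) := by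
    intro i j hi h1 h2
    have hprod : (0 : ℚ) < ((-1) ^ (i : ℕ) * q.eval (j : ℚ)) * (∏ l ∈ T, (e l - j)) ^ 2 := by
      have := mul_pos (hfull i j h1 h2) (hε i j hi h1 h2)
      rw [← Finset.prod_mul_prod_compl T] at this
      simp only [hq, Polynomial.eval_mul, Polynomial.eval_C, Polynomial.eval_prod,
        Polynomial.eval_sub, Polynomial.eval_X]
      linarith
    exact pos_of_mul_pos_left hprod (sq_nonneg _)
  have hterm : ∀ (i : Fin (p + 1)), ∀ j ∈ Finset.Icc (dl i) (du i),
      0 ≤ (-1 : ℚ) ^ (i : ℕ) * q.eval (j : ℚ) * D i j := by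
    intro i j hj
    by_cases hi : i = i₀
    · rw [hi, hzero, mul_zero]
    · exact mul_nonneg (hqpos i j hi (Finset.mem_Icc.1 hj).1 (Finset.mem_Icc.1 hj).2).le (hpos _ _)
  have hsum := sum_eval_eq_zero hD hqdeg
  rw [Finset.sum_eq_zero_iff_of_nonneg fun i _ => Finset.sum_nonneg (hterm i)] at hsum
  have h1 := hsum ⟨a, ha⟩ (Finset.mem_univ _)
  rw [Finset.sum_eq_zero_iff_of_nonneg (hterm _)] at h1
  have hw := mem_window_of_ne_zero (i := ⟨a, ha⟩) hD hab
  have h2 := h1 b (Finset.mem_Icc.2 hw)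
  exact mul_ne_zero (hqpos ⟨a, ha⟩ b hai hw.1 hw.2).ne' hab h2

theorem finite_support_column (hD : D ∈ diagramSpace dl du) (i : Fin (p + 1)) :
    {j | D i j ≠ 0}.Finite :=
  (Set.finite_Icc (dl i) (du i)).subset fun _ hj => mem_window_of_ne_zero hD hj

/-- A non-negative diagram in `diagramSpace dl du` with disjoint windows is a non-negative
combination of the pure diagrams of a chain. The least degrees in the columns form the type of a
pure diagram; a suitable multiple of it is subtracted so that an entry in one of these
positions vanishes and no entry becomes negative. The next types are then larger. -/
theorem exists_chain_decomposition (hl : StrictMono dl) (hu : StrictMono du)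
    (hlu : ∀ i : Fin p, du i.castSucc < dl i.succ) (hD : D ∈ diagramSpace dl du)
    (hpos : ∀ i j, 0 ≤ D i j) :
    ∃ c : (Fin (p + 1) → ℤ) →₀ ℚ, (∀ d, 0 ≤ c d) ∧
      (∀ d ∈ c.support, d ∈ pureTypes dl du ∧ ∀ i : Fin (p + 1), D i (d i) ≠ 0) ∧
      IsChain (· ≤ ·) (c.support : Set (Fin (p + 1) → ℤ)) ∧
      D = c.sum fun d a => a • pureDiagram d := by
  classical
  -- Induction on the number of nonzero entries.
  induction hN : ∑ i : Fin (p + 1), {j | D i j ≠ 0}.ncard using Nat.strong_induction_on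
    generalizing D with
  | _ N ih =>
  by_cases hne : D = 0
  · exact ⟨0, by simp, by simp, by simp, by simp [hne]⟩
  have hcol : ∀ i : Fin (p + 1), ∃ m, D i m ≠ 0 ∧ ∀ j, D i j ≠ 0 → m ≤ j := by
    intro i
    obtain ⟨j, hj⟩ := exists_entry_ne_zero hl hu hlu hD hpos hne i
    obtain ⟨m, hm, hmin⟩ := Set.exists_min_image _ id (finite_support_column hD i) ⟨j, hj⟩
    exact ⟨m, hm, hmin⟩
  choose d hd hdmin using hcol
  have hwin : ∀ i, dl i ≤ d i ∧ d i ≤ du i := fun i => mem_window_of_ne_zero hD (hd i)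
  have hmono : StrictMono d := by
    rw [Fin.strictMono_iff_lt_succ]
    exact fun i => (hwin _).2.trans_lt ((hlu i).trans_le (hwin _).1)
  have hdt : d ∈ pureTypes dl du := ⟨hmono, fun i => (hwin i).1, fun i => (hwin i).2⟩
  obtain ⟨i₁, -, hi₁⟩ := Finset.exists_min_image Finset.univ
    (fun i : Fin (p + 1) => D i (d i) / pureDiagram d i (d i)) Finset.univ_nonempty
  set a : ℚ := D i₁ (d i₁) / pureDiagram d i₁ (d i₁) with ha
  have ha0 : 0 < a := div_pos (lt_of_le_of_ne (hpos _ _) (hd i₁).symm) (pureDiagram_self_pos hmono _)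
  set E : Diagram := D - a • pureDiagram d with hE
  have hEapply : ∀ i j, E i j = D i j - a * pureDiagram d i j := fun i j => rfl
  have hEmem : E ∈ diagramSpace dl du :=
    Submodule.sub_mem _ hD (Submodule.smul_mem _ _ (pureDiagram_mem_diagramSpace hdt))
  have hEpos : ∀ i j, 0 ≤ E i j := by
    intro i j
    rw [hEapply]
    by_cases hi : i < p + 1
    · by_cases hj : j = d ⟨i, hi⟩
      · have := hi₁ ⟨i, hi⟩ (Finset.mem_univ _)
        rw [le_div_iff₀ (pureDiagram_self_pos hmono _)] at this
        rw [hj]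
        exact sub_nonneg.2 this
      · rw [pureDiagram_eq_zero_of_ne (i := ⟨i, hi⟩) hj, mul_zero, sub_zero]
        exact hpos _ _
    · rw [pureDiagram_eq_zero_of_lt j (by omega), mul_zero, sub_zero]
      exact hpos _ _
  have hEsub : ∀ (i : Fin (p + 1)) j, E i j ≠ 0 → D i j ≠ 0 := by
    intro i j h
    by_cases hj : j = d i
    · rw [hj]; exact hd i
    · rwa [hEapply, pureDiagram_eq_zero_of_ne hj, mul_zero, sub_zero] at h
  have hE1 : E i₁ (d i₁) = 0 := by
    rw [hEapply, ha, div_mul_cancel₀ _ (pureDiagram_self_pos hmono _).ne', sub_self]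
  have hlt : ∑ i : Fin (p + 1), {j | E i j ≠ 0}.ncard < N := by
    rw [← hN]
    refine Finset.sum_lt_sum (fun i _ => Set.ncard_le_ncard (fun j hj => hEsub i j hj)
      (finite_support_column hD i)) ⟨i₁, Finset.mem_univ _, ?_⟩
    refine Set.ncard_lt_ncard ⟨fun j hj => hEsub i₁ j hj, fun h => ?_⟩
      (finite_support_column hD i₁)
    exact h (hd i₁) hE1
  obtain ⟨c, hc0, hcs, hchain, hsum⟩ := ih _ hlt hEmem hEpos rfl
  have hdc : d ∉ c.support := fun h => (hcs d h).2 i₁ hE1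
  refine ⟨c + Finsupp.single d a, fun f => ?_, fun f hf => ?_, ?_, ?_⟩
  · rw [Finsupp.add_apply]
    exact add_nonneg (hc0 f) (Finsupp.single_nonneg.2 ha0.le f)
  · rcases Finset.mem_union.1 (Finsupp.support_add hf) with h | h
    · exact ⟨(hcs f h).1, fun i => hEsub i _ ((hcs f h).2 i)⟩
    · rw [Finset.mem_singleton.1 (Finsupp.support_single_subset h)]
      exact ⟨hdt, hd⟩
  · refine IsChain.mono (t := insert d (c.support : Set (Fin (p + 1) → ℤ))) ?_
      (hchain.insert fun f hf _ => Or.inl fun i => hdmin i _ (hEsub i _ ((hcs f hf).2 i)))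
    intro f hf
    rcases Finset.mem_union.1 (Finsupp.support_add hf) with h | h
    · exact Or.inr h
    · exact Or.inl (Finset.mem_singleton.1 (Finsupp.support_single_subset h))
  · rw [Finsupp.sum_add_index' (by simp) (by intros; rw [add_smul]), ← hsum,
      Finsupp.sum_single_index (by simp), hE, sub_add_cancel]

end Decomposition

/-! ### The order complex -/

section OrderComplex

variable {p : ℕ} {dl du : Fin (p + 1) → ℤ} {D : Diagram}

theorem sum_column_zero_pureDiagram {d : Fin (p + 1) → ℤ} (hd : d ∈ pureTypes dl du) :
    ∑ j ∈ Finset.Icc (dl 0) (du 0), pureDiagram d 0 j = 1 := by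
  rw [← pureDiagram_zero_self (d := d)]
  exact Finset.sum_eq_single (d 0) (fun j _ hj => pureDiagram_eq_zero_of_ne (i := 0) hj) fun h =>
    absurd (Finset.mem_Icc.2 ⟨hd.2.1 0, hd.2.2 0⟩) h

/-- A non-negative diagram in `diagramSpace dl du` whose column `0` has sum `1` lies in the order
complex: column `0` of every pure diagram has sum `1`, so the coefficients add up to `1`. -/
theorem mem_orderComplex (hl : StrictMono dl) (hu : StrictMono du)
    (hlu : ∀ i : Fin p, du i.castSucc < dl i.succ) (hD : D ∈ diagramSpace dl du)
    (hpos : ∀ i j, 0 ≤ D i j) (hsum : ∑ j ∈ Finset.Icc (dl 0) (du 0), D 0 j = 1) :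
    D ∈ orderComplex dl du := by
  obtain ⟨c, hc0, hcs, hchain, rfl⟩ := exists_chain_decomposition hl hu hlu hD hpos
  refine Set.mem_biUnion (x := (c.support : Set (Fin (p + 1) → ℤ)))
    ⟨fun d hd => (hcs d hd).1, hchain⟩ ?_
  refine (convex_convexHull ℚ _).sum_mem (fun d _ => hc0 d) ?_
    fun d hd => subset_convexHull ℚ _ ⟨d, hd, rfl⟩
  rw [← hsum]
  simp only [Finsupp.sum, Finset.sum_apply, Pi.smul_apply, smul_eq_mul]
  rw [Finset.sum_comm]
  refine Finset.sum_congr rfl fun d hd => ?_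
  rw [← Finset.mul_sum, sum_column_zero_pureDiagram (hcs d hd).1, mul_one]

theorem orderComplex_eq_convexHull (hl : StrictMono dl) (hu : StrictMono du)
    (hlu : ∀ i : Fin p, du i.castSucc < dl i.succ) :
    orderComplex dl du = convexHull ℚ (pureDiagrams dl du) := by
  apply Set.Subset.antisymm
  · exact Set.iUnion₂_subset fun C hC => convexHull_mono (Set.image_mono hC.1)
  · set K : Set Diagram := {D | D ∈ diagramSpace dl du ∧ (∀ i j, 0 ≤ D i j) ∧
      ∑ j ∈ Finset.Icc (dl 0) (du 0), D 0 j = 1} with hK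
    have hconv : Convex ℚ K := by
      rintro D ⟨h1, h2, h3⟩ E ⟨g1, g2, g3⟩ a b ha hb hab
      refine ⟨Submodule.add_mem _ (Submodule.smul_mem _ _ h1) (Submodule.smul_mem _ _ g1),
        fun i j => add_nonneg (mul_nonneg ha (h2 i j)) (mul_nonneg hb (g2 i j)), ?_⟩
      simp only [Pi.add_apply, Pi.smul_apply, smul_eq_mul, Finset.sum_add_distrib,
        ← Finset.mul_sum, h3, g3, mul_one, hab]
    have hsub : pureDiagrams dl du ⊆ K := by
      rintro _ ⟨d, hd, rfl⟩
      exact ⟨pureDiagram_mem_diagramSpace hd, pureDiagram_nonneg hd.1,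
        sum_column_zero_pureDiagram hd⟩
    exact fun D hD => by
      obtain ⟨h1, h2, h3⟩ := convexHull_min hsub hconv hD
      exact mem_orderComplex hl hu hlu h1 h2 h3

theorem normalize_mem_orderComplex (hl : StrictMono dl) (hu : StrictMono du)
    (hlu : ∀ i : Fin p, du i.castSucc < dl i.succ) (hD : D ∈ diagramSpace dl du)
    (hpos : ∀ i j, 0 ≤ D i j) (hne : D ≠ 0) : D.normalize ∈ orderComplex dl du := by
  have hfin : ∑ᶠ l : ℤ, D 0 l = ∑ j ∈ Finset.Icc (dl 0) (du 0), D 0 j :=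
    finsum_eq_sum_of_support_subset _ fun j hj =>
      Finset.mem_coe.2 (Finset.mem_Icc.2 (mem_window_of_ne_zero (i := 0) hD hj))
  obtain ⟨j₀, hj₀⟩ := exists_entry_ne_zero hl hu hlu hD hpos hne 0
  have hβ : 0 < ∑ j ∈ Finset.Icc (dl 0) (du 0), D 0 j :=
    Finset.sum_pos' (fun j _ => hpos 0 j) ⟨j₀, Finset.mem_Icc.2 (mem_window_of_ne_zero hD hj₀),
      lt_of_le_of_ne (hpos _ _) (Ne.symm hj₀)⟩
  have hnorm : D.normalize = (∑ j ∈ Finset.Icc (dl 0) (du 0), D 0 j)⁻¹ • D := by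
    funext i j
    simp only [Diagram.normalize, hfin, Pi.smul_apply, smul_eq_mul]
    rw [div_eq_inv_mul]
  rw [hnorm]
  refine mem_orderComplex hl hu hlu (Submodule.smul_mem _ _ hD)
    (fun i j => mul_nonneg (inv_nonneg.2 hβ.le) (hpos i j)) ?_
  simp only [Pi.smul_apply, smul_eq_mul, ← Finset.mul_sum]
  exact inv_mul_cancel₀ hβ.ne'

end OrderComplex

/-! ### Vanishing of `Ext` and regular sequences -/

section ExtVanishing

open CategoryTheory Abelian RingTheory.Sequence
open scoped Pointwise

variable {R : Type u} [CommRing R]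

theorem ext_smul_eq_zero_of_mem_annihilator {K N : ModuleCat.{u} R} {r : R}
    (hr : r ∈ Module.annihilator R K) {i : ℕ} (x : Ext K N i) : r • x = 0 := by
  have h : r • 𝟙 K = 0 := by
    exact ModuleCat.hom_ext (LinearMap.ext fun y => Module.mem_annihilator.1 hr y)
  rw [← Ext.mk₀_id_comp x, ← Ext.smul_comp, ← Ext.mk₀_smul, h, Ext.mk₀_zero, Ext.zero_comp]

/-- A linear map with coefficients in the annihilator of `K` acts as zero on `Ext K _ i`. -/
theorem ext_comp_eq_zero_of_mem_annihilator_smul {K : ModuleCat.{u} R} {A B : Type u}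
    [AddCommGroup A] [Module R A] [AddCommGroup B] [Module R B] {f : A →ₗ[R] B}
    (hf : f ∈ Module.annihilator R K • (⊤ : Submodule R (A →ₗ[R] B))) {i : ℕ}
    (x : Ext K (ModuleCat.of R A) i) : x.comp (Ext.mk₀ (ModuleCat.ofHom f)) (add_zero i) = 0 := by
  refine Submodule.smul_induction_on hf (fun r hr g _ => ?_) (fun g g' hg hg' => ?_)
  · have h : ModuleCat.ofHom (r • g) = r • ModuleCat.ofHom g := rfl
    rw [h, Ext.mk₀_smul, Ext.comp_smul, ext_smul_eq_zero_of_mem_annihilator hr]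
  · have h : ModuleCat.ofHom (g + g') = ModuleCat.ofHom g + ModuleCat.ofHom g' := rfl
    rw [h, Ext.mk₀_add, Ext.comp_add, hg, hg', add_zero]

section ShortExact

variable {A B C : Type u} [AddCommGroup A] [Module R A] [AddCommGroup B] [Module R B]
  [AddCommGroup C] [Module R C] {f : A →ₗ[R] B} {g : B →ₗ[R] C}

theorem ext_comp_injective_zero (K : ModuleCat.{u} R) (hf : Function.Injective f)
    (x : Ext K (ModuleCat.of R A) 0)
    (hx : x.comp (Ext.mk₀ (ModuleCat.ofHom f)) (add_zero 0) = 0) : x = 0 := by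
  have : Mono (ModuleCat.ofHom f) := (ModuleCat.mono_iff_injective _).2 hf
  exact Ext.postcomp_mk₀_injective_of_mono K (ModuleCat.ofHom f)
    (hx.trans (Ext.zero_comp _ _ _ _ (add_zero 0)).symm)

theorem ext_comp_injective_succ (K : ModuleCat.{u} R) (hf : Function.Injective f)
    (hg : Function.Surjective g) (hfg : Function.Exact f g) {j : ℕ}
    (hC : Subsingleton (Ext K (ModuleCat.of R C) j)) (x : Ext K (ModuleCat.of R A) (j + 1))
    (hx : x.comp (Ext.mk₀ (ModuleCat.ofHom f)) (add_zero (j + 1)) = 0) : x = 0 := by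
  let S : ShortComplex (ModuleCat.{u} R) :=
    ModuleCat.shortComplexOfCompEqZero f g hfg.linearMap_comp_eq_zero
  have hS : S.ShortExact := ModuleCat.shortComplex_shortExact S hfg hf hg
  obtain ⟨y, rfl⟩ := Ext.covariant_sequence_exact₁ K hS x hx rfl
  rw [show y = 0 from hC.elim y 0, Ext.zero_comp]

theorem ext_subsingleton_right (K : ModuleCat.{u} R) (hf : Function.Injective f)
    (hg : Function.Surjective g) (hfg : Function.Exact f g) {j : ℕ}
    (hB : Subsingleton (Ext K (ModuleCat.of R B) j))
    (hA : Subsingleton (Ext K (ModuleCat.of R A) (j + 1))) :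
    Subsingleton (Ext K (ModuleCat.of R C) j) := by
  let S : ShortComplex (ModuleCat.{u} R) :=
    ModuleCat.shortComplexOfCompEqZero f g hfg.linearMap_comp_eq_zero
  have hS : S.ShortExact := ModuleCat.shortComplex_shortExact S hfg hf hg
  refine subsingleton_of_forall_eq 0 fun x => ?_
  obtain ⟨y, rfl⟩ := Ext.covariant_sequence_exact₃ K hS x rfl (hA.elim _ _)
  rw [show y = 0 from hB.elim y 0, Ext.zero_comp]

theorem ext_subsingleton_left (K : ModuleCat.{u} R) (hf : Function.Injective f)
    (hg : Function.Surjective g) (hfg : Function.Exact f g) {j : ℕ}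
    (hB : Subsingleton (Ext K (ModuleCat.of R B) j))
    (hC : ∀ i, i + 1 = j → Subsingleton (Ext K (ModuleCat.of R C) i)) :
    Subsingleton (Ext K (ModuleCat.of R A) j) := by
  refine subsingleton_of_forall_eq 0 fun x => ?_
  match j with
  | 0 => exact ext_comp_injective_zero K hf x (hB.elim _ _)
  | i + 1 => exact ext_comp_injective_succ K hf hg hfg (hC i rfl) x (hB.elim _ _)

end ShortExact

section RegularSequence

variable (K : ModuleCat.{u} R)

/-- A weakly `N`-regular sequence of length `l` in the annihilator of `K` forces
`Ext K N i = 0` for `i < l`. -/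
theorem ext_subsingleton_of_isWeaklyRegular {rs : List R}
    (hK : ∀ r ∈ rs, r ∈ Module.annihilator R K) {N : Type u} [AddCommGroup N] [Module R N]
    (hreg : IsWeaklyRegular N rs) {i : ℕ} (hi : i < rs.length) :
    Subsingleton (Ext K (ModuleCat.of R N) i) := by
  induction rs generalizing N i with
  | nil => simp at hi
  | cons r rs ih =>
    rw [isWeaklyRegular_cons_iff] at hreg
    refine subsingleton_of_forall_eq 0 fun x => ?_
    have hx : x.comp (Ext.mk₀ (ModuleCat.ofHom (LinearMap.lsmul R N r))) (add_zero i) = 0 := by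
      refine ext_comp_eq_zero_of_mem_annihilator_smul ?_ x
      have : LinearMap.lsmul R N r = r • LinearMap.id := rfl
      rw [this]
      exact Submodule.smul_mem_smul (hK r List.mem_cons_self) trivial
    match i with
    | 0 => exact ext_comp_injective_zero K (fun _ _ h => hreg.1 h) x hx
    | j + 1 =>
      refine ext_comp_injective_succ K (fun _ _ h => hreg.1 h) (Submodule.mkQ_surjective _)
        (LinearMap.exact_lsmul_mkQ_smul_top N r) ?_ x hx
      exact ih (fun s hs => hK s (List.mem_cons_of_mem _ hs)) hreg.2 (by simpa using hi)

/-- `Hom(K, N / (rs) N)` embeds into `Ext K N l`, where `l` is the length of the weakly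
`N`-regular sequence `rs` in the annihilator of `K`. -/
theorem linearMap_subsingleton_of_ext_length {rs : List R}
    (hK : ∀ r ∈ rs, r ∈ Module.annihilator R K) {N : Type u} [AddCommGroup N] [Module R N]
    (hreg : IsWeaklyRegular N rs) (h : Subsingleton (Ext K (ModuleCat.of R N) rs.length)) :
    Subsingleton (K →ₗ[R] N ⧸ (Ideal.ofList rs • ⊤ : Submodule R N)) := by
  induction rs generalizing N with
  | nil =>
    have hb : (Ideal.ofList ([] : List R) • ⊤ : Submodule R N) = ⊥ := by
      rw [Ideal.ofList_nil, Submodule.bot_smul]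
    have hhom : Subsingleton (K ⟶ ModuleCat.of R N) :=
      (Ext.homEquiv₀ (X := K) (Y := ModuleCat.of R N)).symm.subsingleton_congr.2 h
    have hlin : Subsingleton (K →ₗ[R] N) := ⟨fun a b => by
      have := hhom.elim (ModuleCat.ofHom a) (ModuleCat.ofHom b)
      exact congrArg ModuleCat.Hom.hom this⟩
    exact ((Submodule.quotEquivOfEqBot _ hb).congrRight (M := K)).toEquiv.subsingleton_congr.2 hlin
  | cons r rs ih =>
    rw [isWeaklyRegular_cons_iff] at hreg
    have h1 : Subsingleton (Ext K (ModuleCat.of R (QuotSMulTop r N)) rs.length) :=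
      ext_subsingleton_right K (fun _ _ h => hreg.1 h) (Submodule.mkQ_surjective _)
        (LinearMap.exact_lsmul_mkQ_smul_top N r)
        (ext_subsingleton_of_isWeaklyRegular (rs := r :: rs) K hK
          (isWeaklyRegular_cons_iff N r rs |>.2 hreg) (by simp)) h
    exact ((Submodule.quotOfListConsSMulTopEquivQuotSMulTopInner N r rs).congrRight
      (M := K)).toEquiv.subsingleton_congr.2
        (ih (fun s hs => hK s (List.mem_cons_of_mem _ hs)) hreg.2 h1)

end RegularSequence

end ExtVanishing

/-! ### The length of a minimal resolution -/

section Length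

open CategoryTheory Abelian RingTheory.Sequence MvPolynomial

variable {k : Type u} [Field k] {n : ℕ}

theorem ofList_ofFn_X :
    Ideal.ofList (List.ofFn (X : Fin n → MvPolynomial (Fin n) k)) =
      RingHom.ker (constantCoeff (σ := Fin n) (R := k)) := by
  have h : Ideal.ofList (List.ofFn (X : Fin n → MvPolynomial (Fin n) k)) =
      Ideal.span (X '' (Set.univ : Set (Fin n))) := by
    rw [Ideal.ofList, Set.image_univ]
    congr 1
    ext f
    simp [List.mem_ofFn]
  rw [h]
  ext f
  rw [mem_ideal_span_X_image, RingHom.mem_ker, constantCoeff_eq]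
  constructor
  · intro hf
    by_contra h0
    obtain ⟨i, -, hi⟩ := hf 0 (mem_support_iff.2 h0)
    exact hi rfl
  · intro hf m hm
    have hm0 : m ≠ 0 := by
      rintro rfl
      exact mem_support_iff.1 hm hf
    obtain ⟨i, hi⟩ := Finsupp.ne_iff.1 hm0
    exact ⟨i, trivial, hi⟩

/-- The variables form a regular sequence: ideals generated by variables are described by the
supports of their elements. -/
theorem isWeaklyRegular_ofFn_X :
    IsWeaklyRegular (MvPolynomial (Fin n) k)
      (List.ofFn (X : Fin n → MvPolynomial (Fin n) k)) := by
  rw [isWeaklyRegular_iff]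
  intro i hi
  have hin : i < n := by simpa using hi
  have hideal : Ideal.ofList ((List.ofFn (X : Fin n → MvPolynomial (Fin n) k)).take i) =
      Ideal.span (X '' {j : Fin n | (j : ℕ) < i}) := by
    rw [Ideal.ofList]
    congr 1
    ext f
    simp only [Set.mem_ofPred_eq, List.mem_take_iff_getElem, List.getElem_ofFn, Set.mem_image,
      List.length_ofFn]
    constructor
    · rintro ⟨j, hj, rfl⟩
      exact ⟨⟨j, by omega⟩, by simpa using (show j < i by omega), rfl⟩
    · rintro ⟨j, hj, rfl⟩
      exact ⟨j, by have := j.2; omega, rfl⟩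
  rw [hideal, smul_eq_mul, Ideal.mul_top, List.getElem_ofFn,
    isSMulRegular_iff_right_eq_zero_of_smul]
  intro x hx
  obtain ⟨f, rfl⟩ := Submodule.Quotient.mk_surjective _ x
  rw [← Submodule.Quotient.mk_smul, Submodule.Quotient.mk_eq_zero, smul_eq_mul,
    mem_ideal_span_X_image] at hx
  rw [Submodule.Quotient.mk_eq_zero, mem_ideal_span_X_image]
  intro m hm
  obtain ⟨j, hj, hjm⟩ := hx (Finsupp.single ⟨i, hin⟩ 1 + m) (by
    rw [mem_support_iff, coeff_X_mul]
    exact mem_support_iff.1 hm)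
  refine ⟨j, hj, ?_⟩
  have hne : (⟨i, hin⟩ : Fin n) ≠ j := by
    rintro rfl
    exact Nat.lt_irrefl i hj
  simpa [Finsupp.single_apply, hne] using hjm

theorem isWeaklyRegular_ofFn_X_pi (r : ℕ) :
    IsWeaklyRegular (Fin r → MvPolynomial (Fin n) k)
      (List.ofFn (X : Fin n → MvPolynomial (Fin n) k)) :=
  ((TensorProduct.rid (MvPolynomial (Fin n) k)
    (Fin r → MvPolynomial (Fin n) k)).isWeaklyRegular_congr _).1
      (isWeaklyRegular_ofFn_X.isWeaklyRegular_lTensor)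

variable (k n) in
/-- The residue field of the polynomial ring at the origin, as a module over it. -/
noncomputable abbrev residueModule : ModuleCat.{u} (MvPolynomial (Fin n) k) :=
  ModuleCat.of _ (MvPolynomial (Fin n) k ⧸ RingHom.ker (constantCoeff (σ := Fin n) (R := k)))

theorem mem_annihilator_residueModule {f : MvPolynomial (Fin n) k} (hf : constantCoeff f = 0) :
    f ∈ Module.annihilator (MvPolynomial (Fin n) k) (residueModule k n) := by
  rw [Ideal.annihilator_quotient]
  exact hf

theorem mem_annihilator_of_mem_ofFn_X : ∀ f ∈ List.ofFn (X : Fin n → MvPolynomial (Fin n) k),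
    f ∈ Module.annihilator (MvPolynomial (Fin n) k) (residueModule k n) := by
  intro f hf
  obtain ⟨i, rfl⟩ := (List.mem_ofFn' _ _).1 hf
  exact mem_annihilator_residueModule (constantCoeff_X _ i)

theorem ext_residueModule_free_subsingleton (r : ℕ) {i : ℕ} (hi : i < n) :
    Subsingleton (Ext (residueModule k n)
      (ModuleCat.of _ (Fin r → MvPolynomial (Fin n) k)) i) :=
  ext_subsingleton_of_isWeaklyRegular _ mem_annihilator_of_mem_ofFn_X
    (isWeaklyRegular_ofFn_X_pi r) (by simpa using hi)

/-- `Ext^n` from the residue field detects free modules: it contains `Hom(K, N / m N)`. -/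
theorem rank_eq_zero_of_ext_subsingleton {r : ℕ} (h : Subsingleton (Ext (residueModule k n)
    (ModuleCat.of _ (Fin r → MvPolynomial (Fin n) k)) n)) : r = 0 := by
  by_contra hr
  have h1 := linearMap_subsingleton_of_ext_length (residueModule k n)
    mem_annihilator_of_mem_ofFn_X (isWeaklyRegular_ofFn_X_pi r) (by simpa using h)
  rw [ofList_ofFn_X] at h1
  set I := RingHom.ker (constantCoeff (σ := Fin n) (R := k)) with hI
  set e : Fin r → MvPolynomial (Fin n) k := Pi.single ⟨0, by omega⟩ 1
  -- The class of a basis vector in `N / I N` is the value at `1` of a homomorphism from `R / I`.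
  let φ : (MvPolynomial (Fin n) k ⧸ I) →ₗ[MvPolynomial (Fin n) k]
      (Fin r → MvPolynomial (Fin n) k) ⧸ (I • ⊤ : Submodule (MvPolynomial (Fin n) k)
        (Fin r → MvPolynomial (Fin n) k)) :=
    Submodule.liftQ I ((LinearMap.toSpanSingleton _ _ (Submodule.Quotient.mk e))) (by
      intro f hf
      rw [LinearMap.mem_ker, LinearMap.toSpanSingleton_apply, ← Submodule.Quotient.mk_smul,
        Submodule.Quotient.mk_eq_zero]
      exact Submodule.smul_mem_smul hf trivial)
  have h2 : φ (Submodule.Quotient.mk 1) = 0 := by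
    rw [show φ = 0 from h1.elim φ 0, LinearMap.zero_apply]
  rw [Submodule.liftQ_apply, LinearMap.toSpanSingleton_apply, one_smul,
    Submodule.Quotient.mk_eq_zero] at h2
  have h3 : ∀ v ∈ (I • ⊤ : Submodule (MvPolynomial (Fin n) k) (Fin r → MvPolynomial (Fin n) k)),
      ∀ t, v t ∈ I := by
    intro v hv t
    exact Submodule.smul_induction_on hv (fun a ha w _ => Ideal.mul_mem_right _ _ ha)
      fun v w hv hw => Ideal.add_mem _ hv hw
  have h4 := h3 e h2 ⟨0, by omega⟩
  simp [e, hI, RingHom.mem_ker] at h4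

theorem mem_annihilator_smul_of_constantCoeff_eq_zero {a b : ℕ}
    (f : (Fin a → MvPolynomial (Fin n) k) →ₗ[MvPolynomial (Fin n) k]
      (Fin b → MvPolynomial (Fin n) k))
    (hf : ∀ s t, constantCoeff (f (Pi.single s 1) t) = 0) :
    f ∈ Module.annihilator (MvPolynomial (Fin n) k) (residueModule k n) •
      (⊤ : Submodule (MvPolynomial (Fin n) k) ((Fin a → MvPolynomial (Fin n) k)
        →ₗ[MvPolynomial (Fin n) k] (Fin b → MvPolynomial (Fin n) k))) := by
  classical
  have h : f = ∑ s, ∑ t, f (Pi.single s 1) t •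
      (LinearMap.single (MvPolynomial (Fin n) k) (fun _ => MvPolynomial (Fin n) k) t ∘ₗ
        LinearMap.proj s) := by
    refine LinearMap.pi_ext' fun s' => LinearMap.ext_ring (funext fun t' => ?_)
    simp [Finset.sum_apply, Pi.single_apply]
  rw [h]
  exact Submodule.sum_mem _ fun s _ => Submodule.sum_mem _ fun t _ =>
    Submodule.smul_mem_smul (mem_annihilator_residueModule (hf s t)) trivial

variable {M : Type v} [AddCommGroup M] [Module (MvPolynomial (Fin n) k) M]
  {ℳ : ℤ → AddSubgroup M} (F : MinimalFreeResolution (k := k) (n := n) ℳ)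

namespace MinimalFreeResolution

/-- The cokernel of the differential `F (i + 1) → F i`: for `i = 0` a copy of `M` in the universe
of `k`, for `i > 0` the image of `F i` in `F (i - 1)`. -/
abbrev coker (i : ℕ) : Type u :=
  (Fin (F.rank i) → MvPolynomial (Fin n) k) ⧸ LinearMap.range (F.diff i)

/-- The embedding of the next cokernel as a syzygy module. -/
noncomputable def cokerIncl (i : ℕ) : F.coker (i + 1) →ₗ[MvPolynomial (Fin n) k]
    (Fin (F.rank i) → MvPolynomial (Fin n) k) :=
  Submodule.liftQ _ (F.diff i) (LinearMap.range_le_ker_iff.2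
    (F.exact_succ i).linearMap_comp_eq_zero)

theorem cokerIncl_injective (i : ℕ) : Function.Injective (F.cokerIncl i) := by
  rw [← LinearMap.ker_eq_bot, cokerIncl, Submodule.ker_liftQ_eq_bot]
  exact (F.exact_succ i).linearMap_ker_eq.le

theorem exact_cokerIncl_mkQ (i : ℕ) :
    Function.Exact (F.cokerIncl i) (LinearMap.range (F.diff i)).mkQ := by
  rw [LinearMap.exact_iff, Submodule.ker_mkQ, cokerIncl, Submodule.range_liftQ]

/-- The augmentation identifies the cokernel of the first differential with `M`. -/
noncomputable def cokerZeroEquiv : F.coker 0 ≃ₗ[MvPolynomial (Fin n) k] M :=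
  (Submodule.quotEquivOfEq _ _ F.exact_zero.linearMap_ker_eq.symm).trans
    (F.aug.quotKerEquivOfSurjective F.aug_surjective)

/-- The vanishing range of `Ext(K, _)` grows by one with each syzygy, up to the range of free
modules. -/
theorem ext_coker_subsingleton {rs : List (MvPolynomial (Fin n) k)}
    (hrs : ∀ f ∈ rs, constantCoeff f = 0) (hreg : IsWeaklyRegular M rs) (i : ℕ) {j : ℕ}
    (hjn : j < n) (hj : j < rs.length + i) :
    Subsingleton (Ext (residueModule k n) (ModuleCat.of _ (F.coker i)) j) := by
  induction i generalizing j with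
  | zero =>
    exact ext_subsingleton_of_isWeaklyRegular _
      (fun f hf => mem_annihilator_residueModule (hrs f hf))
      ((F.cokerZeroEquiv.isWeaklyRegular_congr rs).2 hreg) hj
  | succ i ih =>
    exact ext_subsingleton_left _ (F.cokerIncl_injective i) (Submodule.mkQ_surjective _)
      (F.exact_cokerIncl_mkQ i) (ext_residueModule_free_subsingleton _ hjn)
      fun l hl => ih (by omega) (by omega)

/-- The inequality `pd M ≤ n - depth M` of Auslander and Buchsbaum. If `F (q + 1)` is the last
nonzero term and `q + 1 + depth M > n`, then the last map induces an injection on `Ext^n(K, _)`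
with `K` the residue field; but it also induces zero, because it is minimal. -/
theorem rank_eq_zero {rs : List (MvPolynomial (Fin n) k)}
    (hrs : ∀ f ∈ rs, constantCoeff f = 0) (hreg : IsWeaklyRegular M rs) {i : ℕ}
    (hi : 0 < i) (hn : n < rs.length + i) : F.rank i = 0 := by
  obtain ⟨N, hN⟩ := F.finite_length
  -- Descending induction on `i`.
  induction hm : N + 1 - i generalizing i with
  | zero => exact hN i (by omega)
  | succ m ih =>
    obtain ⟨q, rfl⟩ : ∃ q, i = q + 1 := ⟨i - 1, by omega⟩
    have hnext : F.rank (q + 1 + 1) = 0 := ih (by omega) (by omega) (by omega)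
    have hinj : Function.Injective (F.diff q) := by
      rw [← LinearMap.ker_eq_bot, (F.exact_succ q).linearMap_ker_eq, LinearMap.range_eq_bot]
      have : IsEmpty (Fin (F.rank (q + 1 + 1))) := by rw [hnext]; infer_instance
      exact Subsingleton.elim _ _
    have hexact : Function.Exact (F.diff q) (LinearMap.range (F.diff q)).mkQ := by
      rw [LinearMap.exact_iff, Submodule.ker_mkQ]
    refine rank_eq_zero_of_ext_subsingleton (k := k) (n := n)
      (subsingleton_of_forall_eq 0 fun x => ?_)
    have hx := ext_comp_eq_zero_of_mem_annihilator_smul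
      (mem_annihilator_smul_of_constantCoeff_eq_zero (F.diff q) (F.minimal q)) x
    obtain rfl | ⟨l, rfl⟩ : n = 0 ∨ ∃ l, n = l + 1 := by
      rcases n with _ | l
      · exact Or.inl rfl
      · exact Or.inr ⟨l, rfl⟩
    · exact ext_comp_injective_zero _ hinj x hx
    · exact ext_comp_injective_succ _ hinj (Submodule.mkQ_surjective _) hexact
        (F.ext_coker_subsingleton hrs hreg q (by omega) (by omega)) x hx

end MinimalFreeResolution

end Length

/-! ### Growth of filtered pieces and Krull dimension -/

section Growth

open MvPolynomial

theorem finrank_restrictTotalDegree (k : Type u) [Field k] (n m : ℕ) :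
    Module.finrank k (restrictTotalDegree (Fin n) k m) = (m + n).choose n := by
  classical
  have h : {α : Fin n →₀ ℕ | (α.sum fun _ e => e) ≤ m} =
      ((Finset.range (m + 1)).biUnion fun l =>
        (Finset.univ : Finset (Fin n)).finsuppAntidiag l : Finset (Fin n →₀ ℕ)) := by
    ext α
    simp [Finset.mem_finsuppAntidiag, Finsupp.sum_fintype]
  rw [restrictTotalDegree, Module.finrank_eq_nat_card_basis (basisRestrictSupport k _),
    Nat.card_coe_set_eq, h, Set.ncard_coe_finset, Finset.card_biUnion, ← Nat.sum_range_multichoose]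
  · exact Finset.sum_congr rfl fun l _ => by
      rw [Finset.card_finsuppAntidiag_nat_eq_multichoose, Finset.card_univ, Fintype.card_fin]
  · intro a _ b _ hab
    refine Finset.disjoint_left.2 fun α ha hb => hab ?_
    rw [← (Finset.mem_finsuppAntidiag.1 ha).1, (Finset.mem_finsuppAntidiag.1 hb).1]

/-- A product of subspaces, as a subspace of the product. -/
def submodulePiEquiv {k ι : Type*} [Field k] {V : ι → Type*} [∀ i, AddCommGroup (V i)]
    [∀ i, Module k (V i)] (W : ∀ i, Submodule k (V i)) :
    Submodule.pi Set.univ W ≃ₗ[k] ∀ i, W i where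
  toFun v i := ⟨v.1 i, v.2 i trivial⟩
  invFun v := ⟨fun i => v i, fun i _ => (v i).2⟩
  map_add' _ _ := rfl
  map_smul' _ _ := rfl
  left_inv _ := rfl
  right_inv _ := rfl

instance finite_submodule_pi {k ι : Type*} [Field k] [Finite ι] {V : ι → Type*}
    [∀ i, AddCommGroup (V i)] [∀ i, Module k (V i)] (W : ∀ i, Submodule k (V i))
    [∀ i, Module.Finite k (W i)] :
    Module.Finite k (Submodule.pi Set.univ W) :=
  Module.Finite.equiv (submodulePiEquiv W).symm

theorem finrank_submodule_pi {k ι : Type*} [Field k] [Fintype ι] {V : ι → Type*}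
    [∀ i, AddCommGroup (V i)] [∀ i, Module k (V i)] (W : ∀ i, Submodule k (V i))
    [∀ i, Module.Finite k (W i)] :
    Module.finrank k (Submodule.pi Set.univ W) = ∑ i, Module.finrank k (W i) := by
  rw [(submodulePiEquiv W).finrank_eq, Module.finrank_pi_fintype]

/-- Chains of primes lift along injective integral extensions. -/
theorem ringKrullDim_le_of_isIntegral (A S : Type*) [CommRing A] [CommRing S] [Algebra A S]
    [Algebra.IsIntegral A S] [FaithfulSMul A S] : ringKrullDim A ≤ ringKrullDim S := by
  refine iSup_le fun l => ?_
  obtain ⟨P, hP⟩ := Algebra.IsIntegral.comap_surjective A S l.head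
  have : P.asIdeal.LiesOver l.head.asIdeal := ⟨by rw [← hP]; rfl⟩
  obtain ⟨L, hL, -, -⟩ := Ideal.exists_ltSeries_of_hasGoingUp l P.asIdeal
  rw [← hL]
  exact le_iSup (fun L : LTSeries (PrimeSpectrum S) => ((L.length : ℕ∞) : WithBot ℕ∞)) L

variable {k : Type u} [Field k] {n : ℕ}

/-- In a quotient `S` of the polynomial ring, the image of the polynomials of degree `≤ m` has
dimension `O(m ^ d)`, where `d ≤ dim S`: after a Noether normalization `k[y₁, …, y_d] → S`,
multiplication by a variable is expressed in module generators of `S` with coefficients of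
bounded degree. -/
theorem exists_finrank_map_restrictTotalDegree_le {S : Type u} [CommRing S] [Nontrivial S]
    [Algebra k S] (φ : MvPolynomial (Fin n) k →ₐ[k] S) (hφ : Function.Surjective φ) :
    ∃ d c L : ℕ, ((d : ℕ∞) : WithBot ℕ∞) ≤ ringKrullDim S ∧ ∀ m : ℕ,
      Module.finrank k ((restrictTotalDegree (Fin n) k m).map φ.toLinearMap) ≤
        L * (c * (m + 1) + d) ^ d := by
  classical
  have : Algebra.FiniteType k S := Algebra.FiniteType.of_surjective φ hφ
  obtain ⟨d, g, hginj, hgfin⟩ := exists_finite_inj_algHom_of_fg k S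
  let _ : Algebra (MvPolynomial (Fin d) k) S := g.toRingHom.toAlgebra
  have hfin : Module.Finite (MvPolynomial (Fin d) k) S := hgfin
  have hsmul : ∀ (a : MvPolynomial (Fin d) k) (y : S), a • y = g a * y := fun a y => rfl
  obtain ⟨L, s, hs⟩ := Module.Finite.exists_fin (R := MvPolynomial (Fin d) k) (M := S)
  have hrep : ∀ y : S, ∃ a : Fin L → MvPolynomial (Fin d) k, ∑ l, g (a l) * s l = y := fun y =>
    (Submodule.mem_span_range_iff_exists_fun _).1 (hs ▸ Submodule.mem_top)
  choose b hb using hrep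
  -- `c` bounds the degrees in the expressions of `1` and of the products `x_i * s_l`.
  set c : ℕ := (Finset.univ.sup fun l => (b 1 l).totalDegree) ⊔
    Finset.univ.sup fun q : Fin n × Fin L × Fin L => (b (φ (X q.1) * s q.2.1) q.2.2).totalDegree
    with hc
  have hc1 : ∀ l, (b 1 l).totalDegree ≤ c := fun l =>
    (Finset.le_sup (f := fun l => (b 1 l).totalDegree) (Finset.mem_univ l)).trans le_sup_left
  have hcX : ∀ i l l', (b (φ (X i) * s l) l').totalDegree ≤ c := fun i l l' =>
    (Finset.le_sup (f := fun q : Fin n × Fin L × Fin L =>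
      (b (φ (X q.1) * s q.2.1) q.2.2).totalDegree) (Finset.mem_univ (i, l, l'))).trans le_sup_right
  let Ψ : (Fin L → MvPolynomial (Fin d) k) →ₗ[k] S :=
    ∑ l, (LinearMap.mulRight k (s l)) ∘ₗ g.toLinearMap ∘ₗ LinearMap.proj l
  have hΨ : ∀ a, Ψ a = ∑ l, g (a l) * s l := fun a => by simp [Ψ]
  set P : ℕ → Submodule k S := fun e =>
    (Submodule.pi Set.univ fun _ : Fin L => restrictTotalDegree (Fin d) k e).map Ψ with hPdef
  have hPmono : ∀ e e', e ≤ e' → P e ≤ P e' := by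
    rintro e e' he _ ⟨a, ha, rfl⟩
    refine ⟨a, fun l hl => ?_, rfl⟩
    have := (mem_restrictTotalDegree (Fin d) e (a l)).1 (ha l hl)
    exact (mem_restrictTotalDegree (Fin d) e' (a l)).2 (this.trans he)
  have hmulX : ∀ e i, ∀ y ∈ P e, φ (X i) * y ∈ P (e + c) := by
    rintro e i _ ⟨a, ha, rfl⟩
    refine ⟨fun l' => ∑ l, a l * b (φ (X i) * s l) l', fun l' _ => ?_, ?_⟩
    · refine (mem_restrictTotalDegree _ _ _).2 (totalDegree_finsetSum_le fun l _ => ?_)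
      exact (totalDegree_mul _ _).trans (add_le_add
        ((mem_restrictTotalDegree _ _ _).1 (ha l trivial)) (hcX i l l'))
    · simp only [hΨ, map_sum, map_mul, Finset.sum_mul]
      rw [Finset.sum_comm, Finset.mul_sum]
      refine Finset.sum_congr rfl fun l _ => ?_
      simp_rw [mul_assoc]
      rw [← Finset.mul_sum, hb]
      ring
  have hmon : ∀ m : ℕ, ∀ α : Fin n →₀ ℕ, α.degree = m →
      φ (monomial α 1) ∈ P (c * (m + 1)) := by
    intro m
    induction m with
    | zero =>
      intro α hα
      rw [Finsupp.degree_eq_zero_iff] at hα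
      rw [hα, monomial_zero', map_one, map_one]
      exact ⟨b 1, fun l _ => (mem_restrictTotalDegree _ _ _).2 (by simpa using hc1 l),
        (hΨ _).trans (hb 1)⟩
    | succ m ih =>
      intro α hα
      have hα0 : α ≠ 0 := by rintro rfl; simp at hα
      obtain ⟨i, hi⟩ := Finsupp.ne_iff.1 hα0
      have hsplit : α = Finsupp.single i 1 + (α - Finsupp.single i 1) :=
        (add_tsub_cancel_of_le (Finsupp.single_le_iff.2 (Nat.one_le_iff_ne_zero.2 hi))).symm
      have hdeg : (α - Finsupp.single i 1).degree = m := by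
        have := congrArg Finsupp.degree hsplit
        rw [map_add, Finsupp.degree_single, hα] at this
        omega
      rw [hsplit, monomial_single_add, pow_one, map_mul]
      exact hmulX _ i _ (ih _ hdeg)
  have hle : ∀ m : ℕ, (restrictTotalDegree (Fin n) k m).map φ.toLinearMap ≤ P (c * (m + 1)) := by
    rintro m _ ⟨f, hf, rfl⟩
    have hf' := (mem_restrictTotalDegree _ _ _).1 hf
    rw [AlgHom.toLinearMap_apply, f.as_sum, map_sum]
    refine Submodule.sum_mem _ fun α hα => ?_
    have h1 : monomial α (coeff α f) = coeff α f • monomial α (1 : k) := by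
      rw [smul_monomial, smul_eq_mul, mul_one]
    rw [h1, map_smul]
    refine Submodule.smul_mem _ _ (hPmono _ _ ?_ (hmon _ α rfl))
    have h2 : α.degree ≤ m := (le_totalDegree hα).trans hf'
    gcongr
  refine ⟨d, c, L, ?_, fun m => ?_⟩
  · have hfaith : FaithfulSMul (MvPolynomial (Fin d) k) S :=
      (faithfulSMul_iff_algebraMap_injective _ _).2 hginj
    have := ringKrullDim_le_of_isIntegral (MvPolynomial (Fin d) k) S
    rw [MvPolynomial.ringKrullDim_of_isNoetherianRing, ringKrullDim_eq_zero_of_field, zero_add,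
      Nat.card_fin] at this
    exact this
  · calc Module.finrank k ((restrictTotalDegree (Fin n) k m).map φ.toLinearMap)
        ≤ Module.finrank k (P (c * (m + 1))) := Submodule.finrank_mono (hle m)
      _ ≤ _ := Submodule.finrank_map_le _ _
      _ = L * (c * (m + 1) + d).choose d := by
        rw [finrank_submodule_pi]
        simp [finrank_restrictTotalDegree]
      _ ≤ _ := Nat.mul_le_mul_left _ (Nat.choose_le_pow _ _)

/-- The subspace generated by the products of `u₁, …, u_r` with polynomials of degree `≤ m` has
dimension `O(m ^ d)` for some `d` bounded by the dimension of the module. -/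
theorem exists_finrank_map_pi_restrictTotalDegree_le {N : Type u} [AddCommGroup N]
    [Module (MvPolynomial (Fin n) k) N] [Module k N] [IsScalarTower k (MvPolynomial (Fin n) k) N]
    [Module.Finite (MvPolynomial (Fin n) k) N] [Nontrivial N] {r : ℕ}
    (u : (Fin r → MvPolynomial (Fin n) k) →ₗ[MvPolynomial (Fin n) k] N) :
    ∃ d c L : ℕ, ((d : ℕ∞) : WithBot ℕ∞) ≤ Module.supportDim (MvPolynomial (Fin n) k) N ∧
      ∀ m : ℕ, Module.finrank k ((Submodule.pi Set.univ fun _ : Fin r =>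
        restrictTotalDegree (Fin n) k m).map (u.restrictScalars k)) ≤
          L * (c * (m + 1) + d) ^ d := by
  classical
  set I := Module.annihilator (MvPolynomial (Fin n) k) N with hI
  have : Nontrivial (MvPolynomial (Fin n) k ⧸ I) :=
    Ideal.Quotient.nontrivial_iff.2 fun h => by
      rw [hI, Module.annihilator_eq_top_iff] at h
      exact not_subsingleton N h
  obtain ⟨d, c, L, hd, hL⟩ := exists_finrank_map_restrictTotalDegree_le
    (Ideal.Quotient.mkₐ k I) (Ideal.Quotient.mkₐ_surjective k I)
  refine ⟨d, c, r * L, hd.trans_eq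
    (Module.supportDim_eq_ringKrullDim_quotient_annihilator _ N).symm, fun m => ?_⟩
  let θ : (t : Fin r) → (MvPolynomial (Fin n) k ⧸ I) →ₗ[k] N := fun t =>
    (Submodule.liftQ I (LinearMap.toSpanSingleton (MvPolynomial (Fin n) k) N (u (Pi.single t 1)))
      fun f hf => by
        rw [LinearMap.mem_ker, LinearMap.toSpanSingleton_apply]
        exact Module.mem_annihilator.1 hf _).restrictScalars k
  let Θ : (Fin r → MvPolynomial (Fin n) k ⧸ I) →ₗ[k] N := ∑ t, θ t ∘ₗ LinearMap.proj t
  set V := Submodule.pi Set.univ fun _ : Fin r =>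
    (restrictTotalDegree (Fin n) k m).map (Ideal.Quotient.mkₐ k I).toLinearMap with hV
  have hle : (Submodule.pi Set.univ fun _ : Fin r => restrictTotalDegree (Fin n) k m).map
      (u.restrictScalars k) ≤ V.map Θ := by
    rintro _ ⟨v, hv, rfl⟩
    refine ⟨fun t => Ideal.Quotient.mkₐ k I (v t), fun t ht => ⟨v t, hv t ht, rfl⟩, ?_⟩
    have hΘ : Θ (fun t => Ideal.Quotient.mkₐ k I (v t)) = ∑ t, v t • u (Pi.single t 1) := by
      simp only [Θ, LinearMap.sum_apply, LinearMap.comp_apply, LinearMap.proj_apply]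
      rfl
    rw [hΘ, LinearMap.restrictScalars_apply, u.pi_apply_eq_sum_univ v]
    refine Finset.sum_congr rfl fun t _ => ?_
    congr 2
    funext j
    simp [Pi.single_apply, eq_comm]
  calc _ ≤ Module.finrank k (V.map Θ) := Submodule.finrank_mono hle
    _ ≤ Module.finrank k V := Submodule.finrank_map_le _ _
    _ = ∑ _t : Fin r, Module.finrank k
        ((restrictTotalDegree (Fin n) k m).map (Ideal.Quotient.mkₐ k I).toLinearMap) :=
      finrank_submodule_pi _
    _ ≤ ∑ _t : Fin r, L * (c * (m + 1) + d) ^ d := Finset.sum_le_sum fun _ _ => hL m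
    _ = r * L * (c * (m + 1) + d) ^ d := by simp [mul_assoc]

end Growth

/-! ### Polynomials of bounded growth -/

section PolynomialGrowth

open Polynomial Filter

theorem natDegree_le_of_eval_le {Q G : ℚ[X]} {d m₀ : ℕ} (hG : G.natDegree ≤ d)
    (h0 : ∀ m : ℕ, m₀ ≤ m → 0 ≤ Q.eval (m : ℚ))
    (h1 : ∀ m : ℕ, m₀ ≤ m → Q.eval (m : ℚ) ≤ G.eval (m : ℚ)) :
    Q.natDegree ≤ d := by
  by_contra! hlt
  have hQ0 : 0 < Q.degree := natDegree_pos_iff_degree_pos.1 (by omega)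
  have hdeg : G.degree < Q.degree := degree_lt_degree (by omega)
  rcases le_total 0 Q.leadingCoeff with hlc | hlc
  · have ht := ((Q - G).tendsto_atTop_of_leadingCoeff_nonneg
      (by rwa [degree_sub_eq_left_of_degree_lt hdeg])
      (by rwa [leadingCoeff_sub_of_degree_lt hdeg])).comp
        (tendsto_natCast_atTop_atTop (R := ℚ))
    obtain ⟨m, hm, hm'⟩ := ((ht.eventually_gt_atTop 0).and (eventually_ge_atTop m₀)).exists
    have := h1 m hm'
    simp only [Function.comp_apply, eval_sub] at hm
    linarith
  · have ht := (Q.tendsto_atBot_of_leadingCoeff_nonpos hQ0 hlc).comp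
      (tendsto_natCast_atTop_atTop (R := ℚ))
    obtain ⟨m, hm, hm'⟩ := ((ht.eventually_lt_atBot 0).and (eventually_ge_atTop m₀)).exists
    have := h0 m hm'
    simp only [Function.comp_apply] at hm
    linarith

/-- If a combination of translates of a polynomial of degree `n` has degree `≤ d`, then the power
sums `∑ c z ^ s` with `s + d < n` vanish: the coefficient in degree `n - s` of the combination is a
nonzero multiple of the `s`-th power sum, plus a combination of lower power sums. -/
theorem sum_mul_pow_eq_zero_of_natDegree_le {ι : Type*} (I : Finset ι) (c z : ι → ℚ) {B : ℚ[X]}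
    {n d : ℕ} (hB : B.natDegree = n) (hB0 : B ≠ 0)
    (hd : (∑ x ∈ I, c x • taylor (z x) B).natDegree ≤ d) {s : ℕ} (hs : s + d < n) :
    ∑ x ∈ I, c x * z x ^ s = 0 := by
  induction s using Nat.strong_induction_on with
  | _ s ih =>
  have h1 : (∑ x ∈ I, c x • taylor (z x) B).coeff (n - s) = 0 :=
    coeff_eq_zero_of_natDegree_lt (by omega)
  have h2 : ∀ x, (taylor (z x) B).coeff (n - s) = ∑ l ∈ Finset.range (s + 1),
      (hasseDeriv (n - s) B).coeff l * z x ^ l := fun x => by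
    rw [taylor_coeff]
    refine eval_eq_sum_range' ?_ _
    have := natDegree_hasseDeriv_le B (n - s)
    omega
  simp only [finsetSum_coeff, coeff_smul, smul_eq_mul, h2, Finset.mul_sum] at h1
  rw [Finset.sum_comm, Finset.sum_range_succ, Finset.sum_eq_zero, zero_add] at h1
  · have h3 : (hasseDeriv (n - s) B).coeff s * ∑ x ∈ I, c x * z x ^ s = 0 := by
      rw [← h1, Finset.mul_sum]
      exact Finset.sum_congr rfl fun x _ => by ring
    refine (mul_eq_zero.1 h3).resolve_left ?_
    rw [hasseDeriv_coeff, show s + (n - s) = n by omega]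
    refine mul_ne_zero (Nat.cast_ne_zero.2 (Nat.choose_pos (by omega)).ne') ?_
    rw [← hB]
    exact leadingCoeff_ne_zero.2 hB0
  · intro l hl
    have hls : l < s := Finset.mem_range.1 hl
    have := ih l hls (by omega)
    calc _ = (hasseDeriv (n - s) B).coeff l * ∑ x ∈ I, c x * z x ^ l := by
          rw [Finset.mul_sum]
          exact Finset.sum_congr rfl fun x _ => by ring
      _ = 0 := by rw [this, mul_zero]

end PolynomialGrowth

/-! ### Hilbert functions and the Herzog–Kühl equations -/

section Truncation

open MvPolynomial

variable {k : Type u} [Field k] {n : ℕ}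

variable (k n) in
/-- The part of a polynomial in degrees `≤ e`, for an integer `e`; it is `0` if `e < 0`. -/
noncomputable def degreeTruncation (e : ℤ) :
    MvPolynomial (Fin n) k →ₗ[k] MvPolynomial (Fin n) k :=
  ∑ l ∈ Finset.range (e + 1).toNat, homogeneousComponent l

theorem degreeTruncation_of_isHomogeneous {e : ℤ} {l : ℕ} {f : MvPolynomial (Fin n) k}
    (hf : f.IsHomogeneous l) :
    degreeTruncation k n e f = if (l : ℤ) ≤ e then f else 0 := by
  simp only [degreeTruncation, LinearMap.sum_apply,
    homogeneousComponent_of_mem ((mem_homogeneousSubmodule l f).2 hf), Finset.sum_ite_eq',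
    Finset.mem_range]
  congr 1
  simp only [eq_iff_iff]
  omega

theorem degreeTruncation_mul {e : ℤ} {a : ℕ} {h : MvPolynomial (Fin n) k}
    (hh : h.IsHomogeneous a) (f : MvPolynomial (Fin n) k) :
    degreeTruncation k n (e + a) (f * h) = degreeTruncation k n e f * h := by
  rw [← sum_homogeneousComponent f, Finset.sum_mul, map_sum, map_sum, Finset.sum_mul]
  refine Finset.sum_congr rfl fun l _ => ?_
  have hl := homogeneousComponent_isHomogeneous l f
  rw [degreeTruncation_of_isHomogeneous hl, degreeTruncation_of_isHomogeneous (hl.mul hh)]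
  by_cases hle : (l : ℤ) ≤ e
  · rw [if_pos hle, if_pos (by push_cast; omega)]
  · rw [if_neg hle, if_neg (by push_cast; omega), zero_mul]

theorem degreeTruncation_mem {e : ℤ} (he : 0 ≤ e) (f : MvPolynomial (Fin n) k) :
    degreeTruncation k n e f ∈ restrictTotalDegree (Fin n) k e.toNat := by
  rw [degreeTruncation, LinearMap.sum_apply]
  refine Submodule.sum_mem _ fun l hl => (mem_restrictTotalDegree _ _ _).2 ?_
  have := (homogeneousComponent_isHomogeneous l f).totalDegree_le
  have := Finset.mem_range.1 hl
  omega

theorem degreeTruncation_of_mem {e : ℤ} (he : 0 ≤ e) {f : MvPolynomial (Fin n) k}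
    (hf : f ∈ restrictTotalDegree (Fin n) k e.toNat) : degreeTruncation k n e f = f := by
  have hd := (mem_restrictTotalDegree _ _ _).1 hf
  rw [← sum_homogeneousComponent f, map_sum]
  refine Finset.sum_congr rfl fun l hl => ?_
  rw [degreeTruncation_of_isHomogeneous (homogeneousComponent_isHomogeneous l f), if_pos]
  have := Finset.mem_range.1 hl
  omega

end Truncation

theorem Submodule.finrank_map_add_finrank_inf_ker {k V W : Type*} [Field k] [AddCommGroup V]
    [Module k V] [AddCommGroup W] [Module k W] (f : V →ₗ[k] W) (U : Submodule k V)
    [Module.Finite k U] :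
    Module.finrank k (U.map f) + Module.finrank k (U ⊓ LinearMap.ker f : Submodule k V) =
      Module.finrank k U := by
  rw [← (f.domRestrict U).finrank_range_add_finrank_ker, LinearMap.range_domRestrict,
    LinearMap.ker_domRestrict, inf_comm,
    ← (Submodule.comapSubtypeEquivOfLe (inf_le_right : LinearMap.ker f ⊓ U ≤ U)).finrank_eq,
    Submodule.comap_inf, Submodule.comap_subtype_self, inf_top_eq]

namespace MinimalFreeResolution

open MvPolynomial

variable {k : Type u} [Field k] {n : ℕ} {M : Type v} [AddCommGroup M]
  [Module (MvPolynomial (Fin n) k) M] {ℳ : ℤ → AddSubgroup M}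
  (F : MinimalFreeResolution (k := k) (n := n) ℳ)

theorem exists_shift_le : ∃ m₀ : ℕ, ∀ i t, F.shift i t ≤ m₀ := by
  obtain ⟨N, hN⟩ := F.finite_length
  refine ⟨(Finset.range (N + 1)).sup fun i => Finset.univ.sup fun t => (F.shift i t).toNat,
    fun i t => ?_⟩
  have hi : i ∈ Finset.range (N + 1) := by
    rw [Finset.mem_range]
    by_contra h
    have := hN i (by omega)
    exact (Fin.cast this t).elim0
  have h1 := Finset.le_sup (f := fun t => (F.shift i t).toNat) (Finset.mem_univ t)
  have h2 := Finset.le_sup (f := fun i => Finset.univ.sup fun t => (F.shift i t).toNat) hi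
  have h3 := h1.trans h2
  have h4 := Int.self_le_toNat (F.shift i t)
  exact h4.trans (by exact_mod_cast h3)

/-- The elements of the `i`-th free module in degrees `≤ m`, provided that no basis element has
degree `> m`. -/
noncomputable def degreeLE (i m : ℕ) : Submodule k (Fin (F.rank i) → MvPolynomial (Fin n) k) :=
  Submodule.pi Set.univ fun t => restrictTotalDegree (Fin n) k ((m : ℤ) - F.shift i t).toNat

instance (i m : ℕ) : Module.Finite k (F.degreeLE i m) :=
  finite_submodule_pi _

/-- The part in degrees `≤ m` of an element of the `i`-th free module. -/
noncomputable def truncation (i m : ℕ) : (Fin (F.rank i) → MvPolynomial (Fin n) k) →ₗ[k]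
    (Fin (F.rank i) → MvPolynomial (Fin n) k) :=
  LinearMap.pi fun t => degreeTruncation k n ((m : ℤ) - F.shift i t) ∘ₗ LinearMap.proj t

/-- The differentials preserve degrees, so they commute with truncation. -/
theorem diff_truncation (i m : ℕ) (v : Fin (F.rank (i + 1)) → MvPolynomial (Fin n) k) :
    F.diff i (F.truncation (i + 1) m v) = F.truncation i m (F.diff i v) := by
  classical
  have hcoord : ∀ w t, F.diff i w t = ∑ s, w s * F.diff i (Pi.single s 1) t := by
    intro w t
    rw [(F.diff i).pi_apply_eq_sum_univ w, Finset.sum_apply]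
    refine Finset.sum_congr rfl fun s _ => ?_
    rw [Pi.smul_apply, smul_eq_mul]
    congr 1
    refine congrArg (fun w => F.diff i w t) (funext fun j => ?_)
    simp [Pi.single_apply, eq_comm]
  funext t
  simp only [truncation, LinearMap.pi_apply, LinearMap.comp_apply, LinearMap.proj_apply]
  rw [hcoord, hcoord, map_sum]
  refine Finset.sum_congr rfl fun s _ => ?_
  rw [LinearMap.pi_apply, LinearMap.comp_apply, LinearMap.proj_apply]
  rcases F.diff_homogeneous i s t with h | ⟨e, he, hh⟩
  · rw [h, mul_zero, mul_zero, map_zero]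
  · rw [← degreeTruncation_mul hh, he]
    congr 2
    ring

section

variable {m : ℕ} (hm : ∀ i t, F.shift i t ≤ m)
include hm

theorem truncation_mem (i : ℕ) (v : Fin (F.rank i) → MvPolynomial (Fin n) k) :
    F.truncation i m v ∈ F.degreeLE i m :=
  fun t _ => degreeTruncation_mem (sub_nonneg.2 (hm i t)) _

theorem truncation_of_mem {i : ℕ} {v : Fin (F.rank i) → MvPolynomial (Fin n) k}
    (hv : v ∈ F.degreeLE i m) : F.truncation i m v = v := by
  funext t
  have ht : v t ∈ restrictTotalDegree (Fin n) k ((m : ℤ) - F.shift i t).toNat := hv t trivial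
  exact degreeTruncation_of_mem (sub_nonneg.2 (hm i t)) ht

/-- Exactness of the resolution is inherited by the parts in degrees `≤ m`. -/
theorem map_diff_degreeLE (i : ℕ) :
    (F.degreeLE (i + 1) m).map ((F.diff i).restrictScalars k) =
      F.degreeLE i m ⊓ (LinearMap.range (F.diff i)).restrictScalars k := by
  ext w
  constructor
  · rintro ⟨v, hv, rfl⟩
    refine ⟨?_, v, rfl⟩
    rw [LinearMap.restrictScalars_apply, ← F.truncation_of_mem hm hv, F.diff_truncation]
    exact F.truncation_mem hm _ _
  · rintro ⟨hw, v, rfl⟩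
    refine ⟨F.truncation (i + 1) m v, F.truncation_mem hm _ _, ?_⟩
    rw [LinearMap.restrictScalars_apply, F.diff_truncation]
    exact F.truncation_of_mem hm hw

theorem finrank_degreeLE_succ (i : ℕ) :
    Module.finrank k ((F.degreeLE (i + 1) m).map ((F.diff i).restrictScalars k)) +
      Module.finrank k ((F.degreeLE (i + 2) m).map ((F.diff (i + 1)).restrictScalars k)) =
        Module.finrank k (F.degreeLE (i + 1) m) := by
  rw [F.map_diff_degreeLE hm (i + 1), ← (F.exact_succ i).linearMap_ker_eq]
  exact Submodule.finrank_map_add_finrank_inf_ker ((F.diff i).restrictScalars k) _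

theorem finrank_degreeLE_zero :
    Module.finrank k ((F.degreeLE 0 m).map
      ((LinearMap.range (F.diff 0)).mkQ.restrictScalars k)) +
      Module.finrank k ((F.degreeLE 1 m).map ((F.diff 0).restrictScalars k)) =
        Module.finrank k (F.degreeLE 0 m) := by
  have h : F.degreeLE 0 m ⊓ (LinearMap.range (F.diff 0)).restrictScalars k =
      F.degreeLE 0 m ⊓
        LinearMap.ker ((LinearMap.range (F.diff 0)).mkQ.restrictScalars k) := by
    rw [LinearMap.ker_restrictScalars, Submodule.ker_mkQ]
  rw [F.map_diff_degreeLE hm 0, h]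
  exact Submodule.finrank_map_add_finrank_inf_ker _ _

/-- The Euler characteristic of the resolution in degrees `≤ m`. -/
theorem sum_finrank_degreeLE {N : ℕ} (hN : ∀ i, N < i → F.rank i = 0) :
    ∑ i ∈ Finset.range (N + 1), (-1 : ℚ) ^ i * Module.finrank k (F.degreeLE i m) =
      Module.finrank k ((F.degreeLE 0 m).map
        ((LinearMap.range (F.diff 0)).mkQ.restrictScalars k)) := by
  have key : ∀ j, ∑ i ∈ Finset.range (j + 1), (-1 : ℚ) ^ i * Module.finrank k (F.degreeLE i m) =
      Module.finrank k ((F.degreeLE 0 m).map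
        ((LinearMap.range (F.diff 0)).mkQ.restrictScalars k)) +
      (-1) ^ j * Module.finrank k
        ((F.degreeLE (j + 1) m).map ((F.diff j).restrictScalars k)) := by
    intro j
    induction j with
    | zero =>
      rw [Finset.sum_range_one, pow_zero, one_mul, one_mul]
      exact_mod_cast (F.finrank_degreeLE_zero hm).symm
    | succ j ih =>
      rw [Finset.sum_range_succ, ih, ← F.finrank_degreeLE_succ hm j]
      push_cast
      ring
  have h0 : (F.degreeLE (N + 1) m).map ((F.diff N).restrictScalars k) = ⊥ := by
    have : IsEmpty (Fin (F.rank (N + 1))) := by rw [hN _ N.lt_succ_self]; infer_instance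
    rw [eq_bot_iff]
    rintro _ ⟨v, -, rfl⟩
    rw [Subsingleton.elim v 0, map_zero]
    exact Submodule.zero_mem _
  rw [key N, h0, finrank_bot, Nat.cast_zero, mul_zero, add_zero]

theorem finrank_degreeLE (i : ℕ) :
    (Module.finrank k (F.degreeLE i m) : ℚ) = ∑ t, (Polynomial.taylor (-(F.shift i t : ℚ))
      (Polynomial.preHilbertPoly ℚ n 0)).eval (m : ℚ) := by
  rw [degreeLE, finrank_submodule_pi, Nat.cast_sum]
  refine Finset.sum_congr rfl fun t _ => ?_
  obtain ⟨e, he⟩ := Int.eq_ofNat_of_zero_le (sub_nonneg.2 (hm i t))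
  have hx : (m : ℚ) + -(F.shift i t : ℚ) = (e : ℚ) := by
    rw [← sub_eq_add_neg]; exact_mod_cast he
  rw [finrank_restrictTotalDegree, he, Int.toNat_natCast, Polynomial.taylor_apply,
    Polynomial.eval_comp, Polynomial.eval_add, Polynomial.eval_X, Polynomial.eval_C, hx,
    Polynomial.preHilbertPoly_eq_choose_sub_add ℚ n (Nat.zero_le e), Nat.sub_zero]

end

/-- The Herzog–Kühl equations. The dimension of the part of `M` in degrees `≤ m` is, for large `m`,
a polynomial in `m` given by the resolution; by the growth bound it has degree at most `dim M`. -/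
theorem alternating_sum_shift_pow_eq_zero [Module.Finite (MvPolynomial (Fin n) k) M]
    [Nontrivial M] {p : ℕ} (hp : ringKrullDim (MvPolynomial (Fin n) k) =
      Module.supportDim (MvPolynomial (Fin n) k) M + (p : WithBot ℕ∞))
    {N : ℕ} (hN : ∀ i, N < i → F.rank i = 0) {s : ℕ} (hs : s < p) :
    ∑ i ∈ Finset.range (N + 1), (-1 : ℚ) ^ i * ∑ t, (F.shift i t : ℚ) ^ s = 0 := by
  have : Nontrivial (F.coker 0) := F.cokerZeroEquiv.toEquiv.nontrivial
  obtain ⟨d, c, L, hd, hL⟩ := exists_finrank_map_pi_restrictTotalDegree_le (k := k)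
    (LinearMap.range (F.diff 0)).mkQ
  have hdp : d + p ≤ n := by
    have h1 := add_le_add_left hd (p : WithBot ℕ∞)
    rw [Module.supportDim_eq_of_equiv F.cokerZeroEquiv, ← hp,
      MvPolynomial.ringKrullDim_of_isNoetherianRing, ringKrullDim_eq_zero_of_field, zero_add,
      Nat.card_fin] at h1
    exact_mod_cast h1
  obtain ⟨m₀, hm₀⟩ := F.exists_shift_le
  -- `a` bounds the negative shifts, so the part in degrees `≤ m` uses coefficients of
  -- degree `≤ m + a`.
  obtain ⟨a, ha⟩ : ∃ a : ℕ, ∀ t, -F.shift 0 t ≤ a :=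
    ⟨Finset.univ.sup fun t => (-F.shift 0 t).toNat, fun t =>
      (Int.self_le_toNat _).trans (by
        exact_mod_cast Finset.le_sup (f := fun t => (-F.shift 0 t).toNat) (Finset.mem_univ t))⟩
  set B := Polynomial.preHilbertPoly ℚ n 0 with hB
  set I : Finset (Σ i : ℕ, Fin (F.rank i)) := (Finset.range (N + 1)).sigma fun _ => Finset.univ
  set Q : Polynomial ℚ := ∑ x ∈ I, (-1 : ℚ) ^ x.1 •
    Polynomial.taylor (-(F.shift x.1 x.2 : ℚ)) B with hQ
  set G : Polynomial ℚ := Polynomial.C (L : ℚ) *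
    (Polynomial.C (c : ℚ) * Polynomial.X + Polynomial.C ((c * (a + 1) + d : ℕ) : ℚ)) ^ d with hG
  have hGdeg : G.natDegree ≤ d := by
    refine (Polynomial.natDegree_C_mul_le _ _).trans (Polynomial.natDegree_pow_le.trans ?_)
    calc d * _ ≤ d * 1 := Nat.mul_le_mul_left d Polynomial.natDegree_linear_le
      _ = d := mul_one d
  have hQeval : ∀ m : ℕ, m₀ ≤ m → Q.eval (m : ℚ) = Module.finrank k ((F.degreeLE 0 m).map
      ((LinearMap.range (F.diff 0)).mkQ.restrictScalars k)) := by
    intro m hm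
    have hm' : ∀ i t, F.shift i t ≤ m := fun i t => (hm₀ i t).trans (by exact_mod_cast hm)
    rw [← F.sum_finrank_degreeLE hm' hN, hQ, Polynomial.eval_finsetSum, Finset.sum_sigma]
    refine Finset.sum_congr rfl fun i _ => ?_
    rw [F.finrank_degreeLE hm', Finset.mul_sum]
    exact Finset.sum_congr rfl fun t _ => by rw [Polynomial.eval_smul, smul_eq_mul]
  have hQG : ∀ m : ℕ, m₀ ≤ m → Q.eval (m : ℚ) ≤ G.eval (m : ℚ) := by
    intro m hm
    have hle : F.degreeLE 0 m ≤
        Submodule.pi Set.univ fun _ => restrictTotalDegree (Fin n) k (m + a) := by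
      intro v hv t ht
      refine (mem_restrictTotalDegree _ _ _).2
        (((mem_restrictTotalDegree _ _ _).1 (hv t ht)).trans ?_)
      have := ha t
      omega
    have h1 := (Submodule.finrank_mono (Submodule.map_mono (f :=
      (LinearMap.range (F.diff 0)).mkQ.restrictScalars k) hle)).trans (hL (m + a))
    have h2 : G.eval (m : ℚ) = ((L * (c * (m + a + 1) + d) ^ d : ℕ) : ℚ) := by
      simp only [hG, Polynomial.eval_mul, Polynomial.eval_C, Polynomial.eval_pow,
        Polynomial.eval_add, Polynomial.eval_X]
      push_cast
      ring
    rw [hQeval m hm, h2]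
    exact_mod_cast h1
  have hQdeg : Q.natDegree ≤ d := natDegree_le_of_eval_le hGdeg
    (fun m hm => by rw [hQeval m hm]; exact Nat.cast_nonneg _) hQG
  have hB0 : B ≠ 0 := fun h => by
    have h1 := Polynomial.leadingCoeff_preHilbertPoly ℚ n 0
    rw [← hB, h, Polynomial.leadingCoeff_zero] at h1
    exact inv_ne_zero (Nat.cast_ne_zero.2 n.factorial_ne_zero) h1.symm
  have hsum := sum_mul_pow_eq_zero_of_natDegree_le I (fun x => (-1 : ℚ) ^ x.1)
    (fun x => -(F.shift x.1 x.2 : ℚ)) (Polynomial.natDegree_preHilbertPoly ℚ n 0) hB0 hQdeg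
    (s := s) (by omega)
  have hsign : ∑ i ∈ Finset.range (N + 1), (-1 : ℚ) ^ i * ∑ t, (F.shift i t : ℚ) ^ s =
      (-1) ^ s * ∑ x ∈ I, (-1 : ℚ) ^ x.1 * (-(F.shift x.1 x.2 : ℚ)) ^ s := by
    rw [Finset.sum_sigma, Finset.mul_sum]
    refine Finset.sum_congr rfl fun i _ => ?_
    rw [Finset.mul_sum, Finset.mul_sum]
    refine Finset.sum_congr rfl fun t _ => ?_
    have h1 : (-1 : ℚ) ^ s * (-1) ^ s = 1 := by
      rw [← mul_pow]; norm_num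
    rw [neg_pow (F.shift i t : ℚ)]
    linear_combination -((-1 : ℚ) ^ i * (F.shift i t : ℚ) ^ s) * h1
  rw [hsign, hsum, mul_zero]

end MinimalFreeResolution

/-! ### Betti diagrams of Cohen–Macaulay modules -/

namespace MinimalFreeResolution

open MvPolynomial RingTheory.Sequence

variable {k : Type u} [Field k] {n : ℕ} {M : Type v} [AddCommGroup M]
  [Module (MvPolynomial (Fin n) k) M] {ℳ : ℤ → AddSubgroup M}
  (F : MinimalFreeResolution (k := k) (n := n) ℳ)

theorem bettiDiagram_nonneg (i : ℕ) (j : ℤ) : 0 ≤ F.bettiDiagram i j :=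
  Nat.cast_nonneg _

theorem bettiDiagram_ne_zero_iff {i : ℕ} {j : ℤ} :
    F.bettiDiagram i j ≠ 0 ↔ ∃ t, F.shift i t = j := by
  rw [bettiDiagram, Nat.cast_ne_zero, Finset.card_ne_zero, Finset.filter_nonempty_iff]
  simp

theorem rank_zero_ne_zero [Nontrivial M] : F.rank 0 ≠ 0 := by
  intro h
  have : IsEmpty (Fin (F.rank 0)) := by rw [h]; infer_instance
  exact not_subsingleton M F.aug_surjective.subsingleton

theorem bettiDiagram_ne_zero [Nontrivial M] : F.bettiDiagram ≠ 0 := fun h => by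
  have h1 := F.bettiDiagram_ne_zero_iff.2
    ⟨⟨0, Nat.pos_of_ne_zero F.rank_zero_ne_zero⟩, rfl⟩
  rw [h] at h1
  exact h1 rfl

/-- In a minimal resolution no nonzero term follows a zero term. -/
theorem rank_succ_eq_zero {i : ℕ} (h : F.rank i = 0) : F.rank (i + 1) = 0 := by
  classical
  by_contra hne
  have : IsEmpty (Fin (F.rank i)) := by rw [h]; infer_instance
  set s : Fin (F.rank (i + 1)) := ⟨0, Nat.pos_of_ne_zero hne⟩
  obtain ⟨w, hw⟩ := (F.exact_succ i (Pi.single s 1)).1 (Subsingleton.elim _ _)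
  have h1 := congrArg constantCoeff (congrFun hw s)
  rw [(F.diff (i + 1)).pi_apply_eq_sum_univ w, Finset.sum_apply, map_sum, Pi.single_eq_same,
    map_one, Finset.sum_eq_zero fun t _ => ?_] at h1
  · exact zero_ne_one h1
  · have h2 : (fun j => if t = j then (1 : MvPolynomial (Fin n) k) else 0) = Pi.single t 1 :=
      funext fun j => by simp [Pi.single_apply, eq_comm]
    rw [h2, Pi.smul_apply, smul_eq_mul, map_mul, F.minimal, mul_zero]

/-- The length of the minimal resolution of a Cohen–Macaulay module is at most its
codimension. -/
theorem rank_eq_zero_of_isCohenMacaulay (hM : IsCohenMacaulay k n M) {p : ℕ}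
    (hp : ringKrullDim (MvPolynomial (Fin n) k) =
      Module.supportDim (MvPolynomial (Fin n) k) M + (p : WithBot ℕ∞)) {i : ℕ} (hi : p < i) :
    F.rank i = 0 := by
  obtain ⟨hnt, hdepth⟩ := hM
  have hdepth' : irrelevantDepth k n M + (p : ℕ∞) = n := by
    rw [← hdepth, MvPolynomial.ringKrullDim_of_isNoetherianRing, ringKrullDim_eq_zero_of_field,
      zero_add, Nat.card_fin] at hp
    exact_mod_cast hp.symm
  obtain ⟨rs, hrs, hreg, hlen⟩ : ∃ rs : List (MvPolynomial (Fin n) k),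
      (∀ f ∈ rs, constantCoeff f = 0) ∧ IsWeaklyRegular M rs ∧ n ≤ rs.length + p := by
    by_contra! hno
    have hpn : p < n := by
      simpa using hno [] (by simp) (IsWeaklyRegular.nil _ M)
    have hle : irrelevantDepth k n M ≤ ((n - p - 1 : ℕ) : ℕ∞) :=
      iSup₂_le fun rs h => by
        have := hno rs h.1 h.2.toIsWeaklyRegular
        exact_mod_cast (show rs.length ≤ n - p - 1 by omega)
    have h1 := add_le_add_left hle (p : ℕ∞)
    rw [hdepth'] at h1
    have h2 : n ≤ n - p - 1 + p := by exact_mod_cast h1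
    omega
  exact F.rank_eq_zero hrs hreg (by omega) (by omega)

/-- Degrees separating the columns of a strictly quasipure resolution. -/
theorem exists_separating_degrees [Nontrivial M] (hq : StrictlyQuasipure F.bettiDiagram) :
    ∃ u : ℕ → ℤ, StrictMono u ∧ (∀ i t, F.shift i t ≤ u i) ∧
      ∀ i t, u i < F.shift (i + 1) t := by
  classical
  have hq' : ∀ i t t', F.shift i t < F.shift (i + 1) t' := fun i t t' =>
    hq i _ _ (F.bettiDiagram_ne_zero_iff.2 ⟨t, rfl⟩) (F.bettiDiagram_ne_zero_iff.2 ⟨t', rfl⟩)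
  have hne0 : (Finset.univ : Finset (Fin (F.rank 0))).Nonempty :=
    ⟨⟨0, Nat.pos_of_ne_zero F.rank_zero_ne_zero⟩, Finset.mem_univ _⟩
  -- The maximal degree of a nonzero column; beyond the last column any larger degree will do.
  let u : ℕ → ℤ := fun i => Nat.rec (Finset.univ.sup' hne0 (F.shift 0)) (fun i x =>
    if h : (Finset.univ : Finset (Fin (F.rank (i + 1)))).Nonempty then
      Finset.univ.sup' h (F.shift (i + 1)) else x + 1) i
  have hu0 : u 0 = Finset.univ.sup' hne0 (F.shift 0) := rfl
  have husucc : ∀ i, u (i + 1) =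
      if h : (Finset.univ : Finset (Fin (F.rank (i + 1)))).Nonempty then
        Finset.univ.sup' h (F.shift (i + 1)) else u i + 1 := fun i => rfl
  have hle : ∀ i t, F.shift i t ≤ u i := by
    intro i t
    cases i with
    | zero => rw [hu0]; exact Finset.le_sup' _ (Finset.mem_univ t)
    | succ i =>
      rw [husucc, dif_pos ⟨t, Finset.mem_univ t⟩]
      exact Finset.le_sup' _ (Finset.mem_univ t)
  have hattained : ∀ i, F.rank i ≠ 0 → ∃ t, u i = F.shift i t := by
    intro i hi
    have hne : (Finset.univ : Finset (Fin (F.rank i))).Nonempty :=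
      ⟨⟨0, Nat.pos_of_ne_zero hi⟩, Finset.mem_univ _⟩
    cases i with
    | zero =>
      obtain ⟨t, -, ht⟩ := Finset.exists_mem_eq_sup' hne (F.shift 0)
      exact ⟨t, hu0.trans ht⟩
    | succ i =>
      obtain ⟨t, -, ht⟩ := Finset.exists_mem_eq_sup' hne (F.shift (i + 1))
      exact ⟨t, by rw [husucc, dif_pos hne, ht]⟩
  have hlt : ∀ i t, u i < F.shift (i + 1) t := by
    intro i t
    have hi : F.rank i ≠ 0 := fun h => (Fin.cast (F.rank_succ_eq_zero h) t).elim0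
    obtain ⟨t', ht'⟩ := hattained i hi
    rw [ht']
    exact hq' i t' t
  refine ⟨u, strictMono_nat_of_lt_succ fun i => ?_, hle, hlt⟩
  by_cases h : (Finset.univ : Finset (Fin (F.rank (i + 1)))).Nonempty
  · obtain ⟨t, -⟩ := h
    exact (hlt i t).trans_le (hle (i + 1) t)
  · rw [husucc, dif_neg h]
    exact lt_add_one _

theorem sum_pow_mul_bettiDiagram {i : ℕ} {l h : ℤ} (hl : ∀ t, l ≤ F.shift i t)
    (hh : ∀ t, F.shift i t ≤ h) (s : ℕ) :
    ∑ j ∈ Finset.Icc l h, (j : ℚ) ^ s * F.bettiDiagram i j = ∑ t, (F.shift i t : ℚ) ^ s := by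
  rw [← Finset.sum_fiberwise_of_maps_to (t := Finset.Icc l h) (g := F.shift i)
    fun t _ => Finset.mem_Icc.2 ⟨hl t, hh t⟩]
  refine Finset.sum_congr rfl fun j _ => ?_
  rw [Finset.sum_congr rfl fun t ht => by rw [(Finset.mem_filter.1 ht).2], Finset.sum_const,
    nsmul_eq_mul, mul_comm]
  rfl

theorem bettiDiagram_mem_diagramSpace [Module.Finite (MvPolynomial (Fin n) k) M] [Nontrivial M]
    {p : ℕ} (hp : ringKrullDim (MvPolynomial (Fin n) k) =
      Module.supportDim (MvPolynomial (Fin n) k) M + (p : WithBot ℕ∞))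
    (hrank : ∀ i, p < i → F.rank i = 0) {dl du : Fin (p + 1) → ℤ}
    (hl : ∀ (i : Fin (p + 1)) t, dl i ≤ F.shift i t)
    (hu : ∀ (i : Fin (p + 1)) t, F.shift i t ≤ du i) :
    F.bettiDiagram ∈ diagramSpace dl du := by
  refine ⟨fun s hs => ?_, fun i j hj => ?_, fun i j hi => ?_⟩
  · rw [← F.alternating_sum_shift_pow_eq_zero hp hrank hs,
      ← Fin.sum_univ_eq_sum_range fun i => (-1 : ℚ) ^ i * ∑ t, (F.shift i t : ℚ) ^ s]
    refine Finset.sum_congr rfl fun i _ => ?_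
    rw [← F.sum_pow_mul_bettiDiagram (hl i) (hu i), Finset.mul_sum]
    exact Finset.sum_congr rfl fun j _ => mul_assoc _ _ _
  · by_contra hne
    obtain ⟨t, rfl⟩ := F.bettiDiagram_ne_zero_iff.1 hne
    rcases hj with hj | hj
    · exact absurd (hl i t) (not_le.2 hj)
    · exact absurd (hu i t) (not_le.2 hj)
  · by_contra hne
    obtain ⟨t, -⟩ := F.bettiDiagram_ne_zero_iff.1 hne
    exact (Fin.cast (hrank i hi) t).elim0

/-- The Betti diagram of a Cohen–Macaulay module with strictly quasipure resolution satisfies the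
equations for windows that do not overlap. -/
theorem exists_disjoint_windows [Module.Finite (MvPolynomial (Fin n) k) M]
    (hM : IsCohenMacaulay k n M) {p : ℕ} (hp : ringKrullDim (MvPolynomial (Fin n) k) =
      Module.supportDim (MvPolynomial (Fin n) k) M + (p : WithBot ℕ∞))
    (hq : StrictlyQuasipure F.bettiDiagram) :
    ∃ dl du : Fin (p + 1) → ℤ, StrictMono dl ∧ StrictMono du ∧
      (∀ i : Fin p, du i.castSucc < dl i.succ) ∧ F.bettiDiagram ∈ diagramSpace dl du := by
  have := hM.1
  obtain ⟨u, hu, hle, hlt⟩ := F.exists_separating_degrees hq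
  obtain ⟨l, hl⟩ := (insert (u 0) (Finset.univ.image (F.shift 0))).bddBelow
  refine ⟨Fin.cons l fun i : Fin p => u i + 1, fun i => u i, ?_, fun i j h => hu h, fun i => ?_,
    F.bettiDiagram_mem_diagramSpace hp (fun i => F.rank_eq_zero_of_isCohenMacaulay hM hp) ?_
      fun i t => hle i t⟩
  · rw [Fin.strictMono_iff_lt_succ]
    intro i
    rw [Fin.cons_succ]
    refine Fin.cases (fun hi => ?_) (fun j hj => ?_) i.castSucc (motive := fun x =>
      (x : ℕ) = i → (Fin.cons l (fun i : Fin p => u i + 1) : Fin (p + 1) → ℤ) x < u i + 1) rfl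
    · rw [Fin.cons_zero, ← hi]
      exact Int.lt_add_one_of_le (hl (Finset.mem_coe.2 (Finset.mem_insert_self _ _)))
    · rw [Fin.cons_succ, ← hj]
      have := hu (show (j : ℕ) < (j.succ : ℕ) by simp)
      omega
  · rw [Fin.cons_succ]
    exact lt_add_one _
  · intro i t
    induction i using Fin.cases with
    | zero =>
      exact hl (Finset.mem_coe.2 (Finset.mem_insert_of_mem
        (Finset.mem_image_of_mem _ (Finset.mem_univ t))))
    | succ i => exact hlt i t

end MinimalFreeResolution

theorem corollary2p12 (k : Type u) [Field k] (n : ℕ) :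
    (∀ (p : ℕ) (M : Type v) [AddCommGroup M] [Module (MvPolynomial (Fin n) k) M]
      [Module.Finite (MvPolynomial (Fin n) k) M] (ℳ : ℤ → AddSubgroup M),
      IsModuleGrading (k := k) (n := n) ℳ → IsCohenMacaulay k n M →
      ringKrullDim (MvPolynomial (Fin n) k) =
        Module.supportDim (MvPolynomial (Fin n) k) M + (p : WithBot ℕ∞) →
      ∀ F : MinimalFreeResolution (k := k) (n := n) ℳ, StrictlyQuasipure F.bettiDiagram →
      ∃ c : (Fin (p + 1) → ℤ) →₀ ℚ, (∀ d, 0 ≤ c d) ∧ (∀ d ∈ c.support, StrictMono d) ∧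
        F.bettiDiagram = c.sum fun d a => a • pureDiagram d) ∧
    (∀ (p : ℕ) (dl du : Fin (p + 1) → ℤ), StrictMono dl → StrictMono du →
      (∀ i : Fin p, du i.castSucc < dl i.succ) →
      normalizedBettiDiagrams.{u, v} k n dl du ⊆ orderComplex dl du ∧
      orderComplex dl du = convexHull ℚ (pureDiagrams dl du)) := by
  refine ⟨fun p M _ _ _ ℳ _ hM hp F hq => ?_, fun p dl du hl hu hlu =>
    ⟨?_, orderComplex_eq_convexHull hl hu hlu⟩⟩
  · obtain ⟨dl, du, hl, hu, hlu, hD⟩ := F.exists_disjoint_windows hM hp hq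
    obtain ⟨c, hc, hcs, -, hsum⟩ :=
      exists_chain_decomposition hl hu hlu hD F.bettiDiagram_nonneg
    exact ⟨c, hc, fun d hd => (hcs d hd).1.1, hsum⟩
  · rintro _ ⟨M, _, _, ℳ, F, -, -, hM, hD, rfl⟩
    have := hM.1
    exact normalize_mem_orderComplex hl hu hlu hD F.bettiDiagram_nonneg F.bettiDiagram_ne_zero
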